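/- All functions and vector fields are $\mathcal C^\infty$. Let $S\subset\mathbb C^2$ be an (embedded, oriented) real hypersurface, not necessarily compact, with defining function $\rho$ (smooth and real-valued on an open set $U$, with $S=\{z\in U:\rho(z)=0\}$ and $d\rho\neq0$ on $S$). Suppose that $S$ is circular (invariant under $z\mapsto e^{i\theta}z$ for all $\theta\in\mathbb R$) and strongly $\mathbb C$-convex, that is, its second fundamental form (the Hessian of $\rho$, up to a positive factor) is positive definite on the maximal complex subspace $H_zS$ of $T_zS$ for every $z\in S$. For $z\in S$ let $w(z)=(w_1(z),w_2(z))$ be the unique vector such that $z_1w_1+z_2w_2=1$ and $Y=w_2\frac{\partial}{\partial z_1}-w_1\frac{\partial}{\partial z_2}$ is tangent to $S$; explicitly $w_j=\rho_{z_j}/(z_1\rho_{z_1}+z_2\rho_{z_2})$, a formula which also extends $w$ to a neighborhood of $S$. Let $V=z_2\frac{\partial}{\partial w_1}-z_1\frac{\partial}{\partial w_2}$, where $\frac{\partial}{\partial w_j}$ is transported to a neighborhood of $S$ by the inverse of the differential of the extended map $w$. A function on a relatively open subset of $S$ is called CR if it is annihilated by all tangential vectors of type $(0,1)$, and dual-CR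 if it is annihilated by $\bar V$. A tangential complex vector field $Z$ on $S$ is said to annihilate exactly the CR (respectively dual-CR) functions if $Z$ is nowhere zero and, for each function $u$ on a relatively open subset of $S$, $u$ is CR (respectively dual-CR) if and only if $Zu=0$. Then there are tangential vector fields $X,T$ on $S$ with the following properties: $X=V+\phi\bar V$ and $T=Y+\psi\bar Y$ on $S$ for some functions $\phi,\psi$ on $S$; $X$ annihilates exactly the CR functions; and $T$ annihilates exactly the dual-CR functions. Moreover, let $X,T$ be any fields with these properties, and let $\tilde X,\tilde T$ be tangential vector fields on $S$ such that $\tilde X$ annihilates exactly the CR functions, $\tilde T$ annihilates exactly the dual-CR functions, and $\tilde X\tilde X\tilde T u=0$ for every CR function and every dual-CR function $u$ on $S$. Then there are CR functions $f_1,f_2,f_3$ on $S$ such that $f_1w_1+f_2w_2$ and $f_3$ are nowhere zero on $S$ and $$\tilde X=f_3\,(f_1w_1+f_2w_2)^2\,X,\qquad \tilde T=\frac{1}{f_1w_1+f_2w_2}\,T .$$ -/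

import Mathlib

open scoped ContDiff

noncomputable section

namespace ProjDual

/-- The space `ℂ²`, with coordinates `z = (z₁, z₂) = (z.1, z.2)`. -/
abbrev C2 : Type := ℂ × ℂ

/-! ### Complex tangent vectors of `ℂ²` -/

/-- Complexified tangent vectors of `ℂ²` at a point: the pair `(a, b)` stands for
`a₁ ∂/∂z₁ + a₂ ∂/∂z₂ + b₁ ∂/∂z̄₁ + b₂ ∂/∂z̄₂`.  Multiplication by complex scalars and addition are
the componentwise ones. -/
abbrev CVec : Type := C2 × C2

/-- The complex tangent vector `u + i v`, where `u` and `v` are real tangent vectors.  A real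
vector `u ∈ ℂ²` is `u₁ ∂/∂z₁ + u₂ ∂/∂z₂ + ū₁ ∂/∂z̄₁ + ū₂ ∂/∂z̄₂`. -/
def CVec.ofReIm (u v : C2) : CVec := (u + Complex.I • v, star u + Complex.I • star v)

/-- The real part `u` of `u + i v`. -/
def CVec.re (A : CVec) : C2 := (1 / 2 : ℂ) • (A.1 + star A.2)

/-- The imaginary part `v` of `u + i v`. -/
def CVec.im (A : CVec) : C2 := (1 / (2 * Complex.I) : ℂ) • (A.1 - star A.2)

/-- The conjugate complex tangent vector `u - i v` of `u + i v`. -/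
def CVec.conj (A : CVec) : CVec := (star A.2, star A.1)

theorem CVec.re_ofReIm (u v : C2) : (CVec.ofReIm u v).re = u := by
  ext <;> simp [CVec.ofReIm, CVec.re] <;> ring

theorem CVec.im_ofReIm (u v : C2) : (CVec.ofReIm u v).im = v := by
  ext <;> simp [CVec.ofReIm, CVec.im] <;> ring_nf <;> simp

theorem CVec.ofReIm_re_im (A : CVec) : CVec.ofReIm A.re A.im = A := by
  ext <;> simp [CVec.ofReIm, CVec.re, CVec.im] <;> ring_nf <;> simp <;> ring

/-- The complex-linear extension to complex tangent vectors of a real-linear map. -/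
def mapC (L : C2 →L[ℝ] C2) (A : CVec) : CVec := CVec.ofReIm (L A.re) (L A.im)

/-! ### Smoothness, vector fields, hypersurfaces -/

/-- A map is smooth on an arbitrary subset `W` of `ℂ²` when it locally extends to a smooth map on
an open subset of `ℂ²`. -/
def SmoothOn {F : Type*} [NormedAddCommGroup F] [NormedSpace ℝ F] (W : Set C2) (f : C2 → F) :
    Prop :=
  ∀ z ∈ W, ∃ (O : Set C2) (g : C2 → F),
    IsOpen O ∧ z ∈ O ∧ ContDiffOn ℝ ∞ g O ∧ Set.EqOn f g (W ∩ O)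

/-- `S` is a (smooth, embedded, oriented) real hypersurface of `ℂ²`, with defining function `ρ` on
the open set `U`. -/
structure IsHypersurface (S U : Set C2) (ρ : C2 → ℝ) : Prop where
  isOpen : IsOpen U
  smooth : ContDiffOn ℝ ∞ ρ U
  eq_zeroSet : S = {z | z ∈ U ∧ ρ z = 0}
  fderiv_ne_zero : ∀ z ∈ S, fderiv ℝ ρ z ≠ 0

/-- `S` is invariant under all the rotations `z ↦ e^{iθ} z`. -/
def IsCircular (S : Set C2) : Prop :=
  ∀ θ : ℝ, ∀ z ∈ S, Complex.exp (θ * Complex.I) • z ∈ S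

/-- The maximal complex subspace `H_z S` of the real tangent space
`T_z S = {v | dρ_z(v) = 0}`. -/
def maxComplexSubspace (ρ : C2 → ℝ) (z : C2) : Set C2 :=
  {v | fderiv ℝ ρ z v = 0 ∧ fderiv ℝ ρ z (Complex.I • v) = 0}

/-- Strong `ℂ`-convexity: the second fundamental form of `S` (on tangent vectors, the Hessian of
the defining function up to a positive factor) is positive definite on `H_z S` for all `z ∈ S`. -/
def IsStronglyCConvex (S : Set C2) (ρ : C2 → ℝ) : Prop :=
  ∀ z ∈ S, ∀ v ∈ maxComplexSubspace ρ z, v ≠ 0 → 0 < fderiv ℝ (fderiv ℝ ρ) z v v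

/-- The complex vector `A` belongs to `T_z S ⊗ ℂ`: its real and imaginary parts are tangent. -/
def IsTangentAt (ρ : C2 → ℝ) (z : C2) (A : CVec) : Prop :=
  fderiv ℝ ρ z A.re = 0 ∧ fderiv ℝ ρ z A.im = 0

/-- Smooth complex tangential vector fields on `S` (only the values on `S` matter). -/
def IsTangentialField (S : Set C2) (ρ : C2 → ℝ) (X : C2 → CVec) : Prop :=
  SmoothOn S X ∧ ∀ z ∈ S, IsTangentAt ρ z (X z)

/-- The function `X f` on `S`, for a tangential field `X` and a smooth function `f` on `S` or on a
relatively open subset of `S`.  For `z ∈ S`, all derivatives of `f` at `z` within `S` agree on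
`T_z S`, where they give the directional derivatives of any smooth extension of `f`. -/
def act (S : Set C2) (X : C2 → CVec) (f : C2 → ℂ) (z : C2) : ℂ :=
  fderivWithin ℝ f S z (X z).re + Complex.I * fderivWithin ℝ f S z (X z).im

/-- `W` is a relatively open subset of `S`. -/
def IsRelOpen (S W : Set C2) : Prop := ∃ O : Set C2, IsOpen O ∧ W = S ∩ O

/-- CR functions on a relatively open subset `W` of `S`: smooth functions annihilated by all the
tangential vectors of type `(0,1)`, that is, `b₁ ∂/∂z̄₁ + b₂ ∂/∂z̄₂`. -/
def IsCR (S : Set C2) (ρ : C2 → ℝ) (W : Set C2) (u : C2 → ℂ) : Prop :=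
  SmoothOn W u ∧ ∀ z ∈ W, ∀ b : C2, IsTangentAt ρ z ((0, b) : CVec) →
    act S (fun _ => ((0, b) : CVec)) u z = 0

/-! ### The dual map and the fields `Y` and `V` -/

/-- `∂ρ/∂z₁`. -/
def dz1 (ρ : C2 → ℝ) (z : C2) : ℂ :=
  (1 / 2 : ℂ) * (fderiv ℝ ρ z (1, 0) - Complex.I * fderiv ℝ ρ z (Complex.I, 0))

/-- `∂ρ/∂z₂`. -/
def dz2 (ρ : C2 → ℝ) (z : C2) : ℂ :=
  (1 / 2 : ℂ) * (fderiv ℝ ρ z (0, 1) - Complex.I * fderiv ℝ ρ z (0, Complex.I))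

/-- The dual map `z ↦ w(z) = (w₁(z), w₂(z))`.  On `S` it depends on `S` only: see
`eq_dualMap_iff`.  The formula also extends it to a neighbourhood of `S`. -/
def dualMap (ρ : C2 → ℝ) (z : C2) : C2 :=
  (dz1 ρ z / (z.1 * dz1 ρ z + z.2 * dz2 ρ z), dz2 ρ z / (z.1 * dz1 ρ z + z.2 * dz2 ρ z))

/-- The field `Y = w₂ ∂/∂z₁ - w₁ ∂/∂z₂`. -/
def fieldY (ρ : C2 → ℝ) (z : C2) : CVec := (((dualMap ρ z).2, -(dualMap ρ z).1), 0)

/-- The field `V = z₂ ∂/∂w₁ - z₁ ∂/∂w₂`, where `∂/∂w₁`, `∂/∂w₂` are carried from the target of the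
(extended) dual map to its source by the inverse of its differential. -/
def fieldV (ρ : C2 → ℝ) (z : C2) : CVec :=
  mapC (fderiv ℝ (dualMap ρ) z).inverse ((z.2, -z.1), 0)

theorem fderiv_eq_dz (ρ : C2 → ℝ) (z v : C2) :
    ((fderiv ℝ ρ z v : ℝ) : ℂ) = dz1 ρ z * v.1 + dz2 ρ z * v.2 +
      (star (dz1 ρ z) * star v.1 + star (dz2 ρ z) * star v.2) := by
  obtain ⟨⟨a, b⟩, ⟨c, d⟩⟩ := v
  have h : ((⟨a, b⟩, ⟨c, d⟩) : C2) = a • ((1, 0) : C2) + b • ((Complex.I, 0) : C2) +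
      (c • ((0, 1) : C2) + d • ((0, Complex.I) : C2)) := by
    ext <;> simp [Complex.mk_eq_add_mul_I]
  rw [h]
  simp only [map_add, map_smul, dz1, dz2]
  apply Complex.ext <;> simp <;> ring

/-- The dual map is characterized by `z₁ w₁ + z₂ w₂ = 1` and the tangency of
`w₂ ∂/∂z₁ - w₁ ∂/∂z₂`, at the points whose complex tangent line misses the origin. -/
theorem eq_dualMap_iff (ρ : C2 → ℝ) (z w : C2) (h0 : z.1 * dz1 ρ z + z.2 * dz2 ρ z ≠ 0) :
    w = dualMap ρ z ↔
      z.1 * w.1 + z.2 * w.2 = 1 ∧ IsTangentAt ρ z (((w.2, -w.1), 0) : CVec) := by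
  have key : IsTangentAt ρ z (((w.2, -w.1), 0) : CVec) ↔
      dz1 ρ z * w.2 - dz2 ρ z * w.1 = 0 := by
    have e1 := fderiv_eq_dz ρ z (CVec.re (((w.2, -w.1), 0) : CVec))
    have e2 := fderiv_eq_dz ρ z (CVec.im (((w.2, -w.1), 0) : CVec))
    simp only [CVec.re, CVec.im] at e1 e2
    unfold IsTangentAt CVec.re CVec.im
    constructor
    · rintro ⟨h1, h2⟩
      rw [h1] at e1
      rw [h2] at e2
      simp at e1 e2
      have e3 := congrArg (fun t => Complex.I * t) e2
      linear_combination (norm := skip) -e1 - e3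
      have hI : Complex.I * Complex.I = -1 := Complex.I_mul_I
      ring_nf
      simp
    · intro h
      have hs := congrArg star h
      simp at hs
      constructor
      · rw [← Complex.ofReal_eq_zero, e1]
        simp
        linear_combination (1 / 2) * h + (1 / 2) * hs
      · rw [← Complex.ofReal_eq_zero, e2]
        simp
        linear_combination (-Complex.I / 2) * h + (Complex.I / 2) * hs
  rw [key]
  constructor
  · rintro rfl
    simp only [dualMap]
    constructor
    · field_simp
    · ring
  · rintro ⟨h1, h2⟩
    ext
    · simp only [dualMap]
      rw [eq_div_iff h0]
      linear_combination dz1 ρ z * h1 - z.2 * h2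
    · simp only [dualMap]
      rw [eq_div_iff h0]
      linear_combination dz2 ρ z * h1 + z.1 * h2

/-- Dual-CR functions on a relatively open subset `W` of `S`. -/
def IsDualCR (S : Set C2) (ρ : C2 → ℝ) (W : Set C2) (u : C2 → ℂ) : Prop :=
  SmoothOn W u ∧ ∀ z ∈ W, act S (fun z => (fieldV ρ z).conj) u z = 0

/-- `X` is a nowhere-vanishing tangential field on `S` which annihilates exactly the CR functions
among the smooth functions on relatively open subsets of `S`. -/
structure IsCRField (S : Set C2) (ρ : C2 → ℝ) (X : C2 → CVec) : Prop where
  tangential : IsTangentialField S ρ X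
  ne_zero : ∀ z ∈ S, X z ≠ 0
  isCR_iff : ∀ W, IsRelOpen S W → ∀ u : C2 → ℂ, SmoothOn W u →
    (IsCR S ρ W u ↔ ∀ z ∈ W, act S X u z = 0)

/-- `T` is a nowhere-vanishing tangential field on `S` which annihilates exactly the dual-CR
functions among the smooth functions on relatively open subsets of `S`. -/
structure IsDualCRField (S : Set C2) (ρ : C2 → ℝ) (T : C2 → CVec) : Prop where
  tangential : IsTangentialField S ρ T
  ne_zero : ∀ z ∈ S, T z ≠ 0
  isDualCR_iff : ∀ W, IsRelOpen S W → ∀ u : C2 → ℂ, SmoothOn W u →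
    (IsDualCR S ρ W u ↔ ∀ z ∈ W, act S T u z = 0)

/-- The distinguished pair of fields: `X = V + φ V̄` annihilates exactly the CR functions and
`T = Y + ψ Ȳ` annihilates exactly the dual-CR functions. -/
structure IsDistinguishedPair (S : Set C2) (ρ : C2 → ℝ) (X T : C2 → CVec) : Prop where
  isCRField : IsCRField S ρ X
  isDualCRField : IsDualCRField S ρ T
  X_eq : ∃ φ : C2 → ℂ, SmoothOn S φ ∧ ∀ z ∈ S, X z = fieldV ρ z + φ z • (fieldV ρ z).conj
  T_eq : ∃ ψ : C2 → ℂ, SmoothOn S ψ ∧ ∀ z ∈ S, T z = fieldY ρ z + ψ z • (fieldY ρ z).conj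

end ProjDual

end

/-!
Write `λ = z₁ ρ_{z₁} + z₂ ρ_{z₂}`, the denominator of the dual map `w`, and let `E = (w₂, -w₁)`, so
that the complex tangent vectors of `S` at `z` are the multiples of `E`.

**The dual map is a local diffeomorphism near `S`.** If `λ` vanished at `z ∈ S`, the velocity `iz`
of the rotation orbit of `z` would be complex tangent, and differentiating `ρ(e^{iθ} z) = 0` twice
would show that the Hessian vanishes on it, against strong `ℂ`-convexity (`radialDz_ne_zero`; the
origin is excluded in `zero_notMem`). On complex tangent vectors the Hessian is `2 Re (λ dw(v) · v)`
(`hessian_eq`). Since `z · dw + w · dz = 0`, the kernel of `dw` consists of complex tangent vectors,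
and so it is trivial.

**The two structures.** The same relation shows that `V` and `V̄` are combinations of `Y` and `Ȳ`,
and `dw(Y)`, `dw(Ȳ)` have `∂/∂w`-components `a (z₂, -z₁)`, `b (z₂, -z₁)`. Averaging the Hessian over
`E` and `iE` gives `Re (λ b) > 0`, hence `b ≠ 0` (`coeffB_ne_zero`). Therefore
`b⁻¹ Ȳ = V + (ā/b) V̄` and `Y - (a/b) Ȳ`, a multiple of `V̄`, form a distinguished pair. A field
which annihilates exactly the CR (dual-CR) functions annihilates `z₁, z₂` (respectively `w₁, w₂`),
which makes it a multiple of the corresponding field of the pair.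

**Rigidity.** Write `X' = g X` and `T' = k T`, and apply `X'X'T'u = 0` to the coordinates
`u = z₁, z₂`. As `T z₁ = w₂`, `T z₂ = -w₁`, `X w₁ = z₂` and `X w₂ = -z₁`, the
product rule expresses `g` and `k` through `w` and three CR functions (`exists_factors`).
-/

noncomputable section

namespace ProjDual

open Filter Topology

/-! ### Complexified tangent vectors -/

/-- The complex-linear extension to complex tangent vectors of a real-linear form with complex
values. -/
def extC (L : C2 →L[ℝ] ℂ) (A : CVec) : ℂ := L A.re + Complex.I * L A.im

theorem act_eq_extC (S : Set C2) (X : C2 → CVec) (f : C2 → ℂ) (z : C2) :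
    act S X f z = extC (fderivWithin ℝ f S z) (X z) := rfl

theorem CVec.re_smul (c : ℂ) (A : CVec) :
    CVec.re (c • A) = c.re • CVec.re A - c.im • CVec.im A := by
  ext <;> apply Complex.ext <;> simp [CVec.re, CVec.im] <;> ring

theorem CVec.im_smul (c : ℂ) (A : CVec) :
    CVec.im (c • A) = c.re • CVec.im A + c.im • CVec.re A := by
  ext <;> apply Complex.ext <;> simp [CVec.re, CVec.im] <;> ring

theorem CVec.re_add (A B : CVec) : CVec.re (A + B) = CVec.re A + CVec.re B := by
  ext <;> simp [CVec.re] <;> ring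

theorem CVec.im_add (A B : CVec) : CVec.im (A + B) = CVec.im A + CVec.im B := by
  ext <;> simp [CVec.im] <;> ring

theorem CVec.re_conj (A : CVec) : CVec.re A.conj = CVec.re A := by
  ext <;> simp [CVec.re, CVec.conj] <;> ring

theorem CVec.im_conj (A : CVec) : CVec.im A.conj = -CVec.im A := by
  ext <;> simp [CVec.im, CVec.conj] <;> ring

theorem CVec.fst_eq (A : CVec) : A.1 = A.re + Complex.I • A.im :=
  (congrArg Prod.fst (CVec.ofReIm_re_im A)).symm

theorem extC_smul (L : C2 →L[ℝ] ℂ) (c : ℂ) (A : CVec) : extC L (c • A) = c * extC L A := by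
  rw [extC, extC, CVec.re_smul, CVec.im_smul, map_sub, map_add]
  simp only [map_smul, Complex.real_smul]
  linear_combination (norm := skip)
    (L (CVec.re A) + Complex.I * L (CVec.im A)) * Complex.re_add_im c
  ring_nf
  simp only [Complex.I_sq]
  ring

theorem mapC_smul (L : C2 →L[ℝ] C2) (c : ℂ) (A : CVec) : mapC L (c • A) = c • mapC L A := by
  simp only [mapC, CVec.re_smul, CVec.im_smul, map_sub, map_add, map_smul, CVec.ofReIm]
  ext <;> apply Complex.ext <;> simp <;> ring

theorem mapC_add (L : C2 →L[ℝ] C2) (A B : CVec) : mapC L (A + B) = mapC L A + mapC L B := by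
  simp only [mapC, CVec.re_add, CVec.im_add, map_add, CVec.ofReIm]
  ext <;> simp <;> ring

theorem mapC_conj (L : C2 →L[ℝ] C2) (A : CVec) : mapC L A.conj = (mapC L A).conj := by
  rw [mapC, mapC, CVec.re_conj, CVec.im_conj, map_neg]
  ext <;> simp [CVec.ofReIm, CVec.conj]

theorem mapC_comp (L M : C2 →L[ℝ] C2) (A : CVec) : mapC L (mapC M A) = mapC (L ∘L M) A := by
  simp only [mapC, CVec.re_ofReIm, CVec.im_ofReIm, ContinuousLinearMap.comp_apply]

theorem mapC_id (A : CVec) : mapC (.id ℝ C2) A = A := CVec.ofReIm_re_im A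

/-- Tangency of a complex vector is a single complex-linear equation. -/
theorem isTangentAt_iff (ρ : C2 → ℝ) (z : C2) (A : CVec) :
    IsTangentAt ρ z A ↔ dz1 ρ z * A.1.1 + dz2 ρ z * A.1.2 +
      (star (dz1 ρ z) * A.2.1 + star (dz2 ρ z) * A.2.2) = 0 := by
  have h : dz1 ρ z * A.1.1 + dz2 ρ z * A.1.2 +
      (star (dz1 ρ z) * A.2.1 + star (dz2 ρ z) * A.2.2) =
      (fderiv ℝ ρ z A.re : ℂ) + Complex.I * (fderiv ℝ ρ z A.im : ℂ) := by
    conv_lhs => rw [← CVec.ofReIm_re_im A]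
    rw [fderiv_eq_dz, fderiv_eq_dz]
    simp [CVec.ofReIm]
    ring
  rw [h, IsTangentAt, Complex.ext_iff]
  simp

theorem contDiff_re : ContDiff ℝ ∞ CVec.re :=
  (contDiff_fst.add ((starL' ℝ : C2 ≃L[ℝ] C2).contDiff.comp contDiff_snd)).const_smul _

theorem contDiff_im : ContDiff ℝ ∞ CVec.im :=
  (contDiff_fst.sub ((starL' ℝ : C2 ≃L[ℝ] C2).contDiff.comp contDiff_snd)).const_smul _

/-! ### Smooth maps on subsets -/

section Smooth

variable {F F' : Type*} [NormedAddCommGroup F] [NormedSpace ℝ F]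
  [NormedAddCommGroup F'] [NormedSpace ℝ F'] {W : Set C2}

theorem SmoothOn.of_contDiffOn {f : C2 → F} {O : Set C2} (hO : IsOpen O)
    (hf : ContDiffOn ℝ ∞ f O) (hW : W ⊆ O) : SmoothOn W f :=
  fun _ hz => ⟨O, f, hO, hW hz, hf, fun _ _ => rfl⟩

theorem SmoothOn.congr {f g : C2 → F} (hf : SmoothOn W f) (h : Set.EqOn g f W) :
    SmoothOn W g := by
  intro z hz
  obtain ⟨O, k, hO, hzO, hk, he⟩ := hf z hz
  exact ⟨O, k, hO, hzO, hk, fun x hx => (h hx.1).trans (he hx)⟩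

theorem SmoothOn.comp {f : C2 → F} {G : F → F'} {Ω : Set F} (hf : SmoothOn W f)
    (hΩ : IsOpen Ω) (hG : ContDiffOn ℝ ∞ G Ω) (hm : ∀ z ∈ W, f z ∈ Ω) :
    SmoothOn W fun z => G (f z) := by
  intro z hz
  obtain ⟨O, k, hO, hzO, hk, he⟩ := hf z hz
  refine ⟨O ∩ k ⁻¹' Ω, fun x => G (k x), hk.continuousOn.isOpen_inter_preimage hO hΩ,
    ⟨hzO, ?_⟩, hG.comp (hk.mono Set.inter_subset_left) fun x hx => hx.2,
    fun x hx => congrArg G (he ⟨hx.1, hx.2.1⟩)⟩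
  change k z ∈ Ω
  rw [← he ⟨hz, hzO⟩]
  exact hm z hz

theorem SmoothOn.prodMk {f : C2 → F} {g : C2 → F'} (hf : SmoothOn W f) (hg : SmoothOn W g) :
    SmoothOn W fun z => (f z, g z) := by
  intro z hz
  obtain ⟨O, k, hO, hzO, hk, he⟩ := hf z hz
  obtain ⟨O', k', hO', hzO', hk', he'⟩ := hg z hz
  refine ⟨O ∩ O', fun x => (k x, k' x), hO.inter hO', ⟨hzO, hzO'⟩,
    (hk.mono Set.inter_subset_left).prodMk (hk'.mono Set.inter_subset_right), fun x hx => ?_⟩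
  simp only [he ⟨hx.1, hx.2.1⟩, he' ⟨hx.1, hx.2.2⟩]

theorem SmoothOn.comp_contDiff {f : C2 → F} {G : F → F'} (hf : SmoothOn W f)
    (hG : ContDiff ℝ ∞ G) : SmoothOn W fun z => G (f z) :=
  hf.comp isOpen_univ hG.contDiffOn fun _ _ => trivial

theorem SmoothOn.add {f g : C2 → F} (hf : SmoothOn W f) (hg : SmoothOn W g) :
    SmoothOn W fun z => f z + g z :=
  (hf.prodMk hg).comp_contDiff (G := fun p : F × F => p.1 + p.2) (by fun_prop)

theorem SmoothOn.neg {f : C2 → F} (hf : SmoothOn W f) : SmoothOn W fun z => -f z :=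
  hf.comp_contDiff (G := fun p : F => -p) (by fun_prop)

theorem SmoothOn.sub {f g : C2 → F} (hf : SmoothOn W f) (hg : SmoothOn W g) :
    SmoothOn W fun z => f z - g z :=
  (hf.prodMk hg).comp_contDiff (G := fun p : F × F => p.1 - p.2) (by fun_prop)

theorem SmoothOn.mul {f g : C2 → ℂ} (hf : SmoothOn W f) (hg : SmoothOn W g) :
    SmoothOn W fun z => f z * g z :=
  (hf.prodMk hg).comp_contDiff (G := fun p : ℂ × ℂ => p.1 * p.2) (by fun_prop)

theorem SmoothOn.smul [NormedSpace ℂ F] [IsScalarTower ℝ ℂ F] {f : C2 → ℂ} {g : C2 → F}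
    (hf : SmoothOn W f) (hg : SmoothOn W g) : SmoothOn W fun z => f z • g z :=
  (hf.prodMk hg).comp_contDiff (G := fun p : ℂ × F => p.1 • p.2) (contDiff_fst.smul contDiff_snd)

theorem SmoothOn.star {f : C2 → ℂ} (hf : SmoothOn W f) : SmoothOn W fun z => star (f z) :=
  hf.comp_contDiff (G := fun p : ℂ => Star.star p) (starL' ℝ : ℂ ≃L[ℝ] ℂ).contDiff

theorem SmoothOn.div {f g : C2 → ℂ} (hf : SmoothOn W f) (hg : SmoothOn W g)
    (h0 : ∀ z ∈ W, g z ≠ 0) : SmoothOn W fun z => f z / g z := by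
  have h := hg.comp (G := fun x : ℂ => x⁻¹) isOpen_compl_singleton (contDiffOn_inv ℝ) h0
  simpa only [div_eq_mul_inv] using hf.mul h

theorem SmoothOn.fst {f : C2 → F × F'} (hf : SmoothOn W f) : SmoothOn W fun z => (f z).1 :=
  hf.comp_contDiff contDiff_fst

theorem SmoothOn.snd {f : C2 → F × F'} (hf : SmoothOn W f) : SmoothOn W fun z => (f z).2 :=
  hf.comp_contDiff contDiff_snd

theorem SmoothOn.of_contDiff {f : C2 → F} (hf : ContDiff ℝ ∞ f) : SmoothOn W f :=
  .of_contDiffOn isOpen_univ hf.contDiffOn (Set.subset_univ _)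

theorem SmoothOn.differentiableWithinAt {f : C2 → F} (hf : SmoothOn W f) {z : C2} (hz : z ∈ W) :
    DifferentiableWithinAt ℝ f W z := by
  obtain ⟨O, k, hO, hzO, hk, he⟩ := hf z hz
  have hd : DifferentiableAt ℝ k z :=
    (hk.contDiffAt (hO.mem_nhds hzO)).differentiableAt (by simp)
  refine hd.differentiableWithinAt.congr_of_eventuallyEq ?_ (he ⟨hz, hzO⟩)
  filter_upwards [inter_mem_nhdsWithin W (hO.mem_nhds hzO)] with x hx using he hx

theorem SmoothOn.star_vec {f : C2 → C2} (hf : SmoothOn W f) :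
    SmoothOn W fun z => Star.star (f z) :=
  hf.comp_contDiff (G := fun p : C2 => Star.star p) (starL' ℝ : C2 ≃L[ℝ] C2).contDiff

end Smooth

/-! ### Tangential derivatives on a hypersurface -/

section Hypersurface

variable {S U : Set C2} {ρ : C2 → ℝ}

theorem IsHypersurface.subset (hS : IsHypersurface S U ρ) : S ⊆ U := by
  intro z hz
  rw [hS.eq_zeroSet] at hz
  exact hz.1

/-- Every real tangent vector is the velocity of a curve in the hypersurface. -/
theorem IsHypersurface.exists_curve (hS : IsHypersurface S U ρ) {z v : C2} (hz : z ∈ S)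
    (hv : fderiv ℝ ρ z v = 0) :
    ∃ c : ℝ → C2, c 0 = z ∧ HasDerivAt c v 0 ∧ ∀ᶠ t in 𝓝 0, c t ∈ S := by
  have hzU := hS.subset hz
  have hρ0 : ρ z = 0 := by
    have := hz
    rw [hS.eq_zeroSet] at this
    exact this.2
  have hst : HasStrictFDerivAt ρ (fderiv ℝ ρ z) z :=
    (hS.smooth.contDiffAt (hS.isOpen.mem_nhds hzU)).hasStrictFDerivAt (by simp)
  have hr : (fderiv ℝ ρ z).range = ⊤ := by
    apply LinearMap.range_eq_top.2
    apply LinearMap.surjective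
    intro h
    exact hS.fderiv_ne_zero z hz (ContinuousLinearMap.coe_injective h)
  let k : (fderiv ℝ ρ z).ker := ⟨v, hv⟩
  have h0 : hst.implicitFunction ρ _ hr (ρ z) 0 = z := by
    simp
  have hd : HasDerivAt (fun t : ℝ => t • k) k 0 := by
    simpa using (hasDerivAt_id (0 : ℝ)).smul_const k
  have hg := hst.to_implicitFunction hr
  have hc : HasDerivAt (fun t : ℝ => hst.implicitFunction ρ _ hr (ρ z) (t • k)) v 0 := by
    have hg' : HasFDerivAt (hst.implicitFunction ρ _ hr (ρ z))
      (fderiv ℝ ρ z).ker.subtypeL ((0 : ℝ) • k) := by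
      rw [zero_smul]
      exact hg.hasFDerivAt
    exact hg'.comp_hasDerivAt (0 : ℝ) hd
  refine ⟨_, by simp, hc, ?_⟩
  have ht : Tendsto (fun t : ℝ => (ρ z, t • k)) (𝓝 0) (𝓝 (ρ z, 0)) := by
    have : Tendsto (fun t : ℝ => t • k) (𝓝 0) (𝓝 0) := by
      simpa using hd.continuousAt.tendsto
    exact tendsto_const_nhds.prodMk_nhds this
  have h1 := ht.eventually (hst.map_implicitFunction_eq hr)
  have h2 : ∀ᶠ t in 𝓝 (0 : ℝ), hst.implicitFunction ρ _ hr (ρ z) (t • k) ∈ U := by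
    apply hc.continuousAt.eventually_mem
    rw [zero_smul, h0]
    exact hS.isOpen.mem_nhds hzU
  filter_upwards [h1, h2] with t ht1 ht2
  rw [hS.eq_zeroSet]
  exact ⟨ht2, ht1.trans hρ0⟩

/-- Derivatives within the hypersurface are unique on real tangent vectors. -/
theorem IsHypersurface.hasFDerivWithinAt_unique (hS : IsHypersurface S U ρ) {z v : C2}
    (hz : z ∈ S) (hv : fderiv ℝ ρ z v = 0) {F : Type*} [NormedAddCommGroup F] [NormedSpace ℝ F]
    {f : C2 → F} {D D' : C2 →L[ℝ] F} (h : HasFDerivWithinAt f D S z)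
    (h' : HasFDerivWithinAt f D' S z) : D v = D' v := by
  obtain ⟨c, hc0, hc, hcS⟩ := hS.exists_curve hz hv
  have key : ∀ E : C2 →L[ℝ] F, HasFDerivWithinAt f E S z → HasDerivAt (f ∘ c) (E v) 0 := by
    intro E hE
    rw [← hc0] at hE
    exact (hE.comp_hasDerivWithinAt (0 : ℝ) (hc.hasDerivWithinAt (s := c ⁻¹' S))
      fun t ht => ht).hasDerivAt hcS
  exact (key D h).unique (key D' h')

/-- A tangential derivative may be computed with any derivative within the hypersurface. -/
theorem IsHypersurface.act_eq (hS : IsHypersurface S U ρ) {z : C2} (hz : z ∈ S) {X : C2 → CVec}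
    (hX : IsTangentAt ρ z (X z)) {f : C2 → ℂ} {D : C2 →L[ℝ] ℂ}
    (h : HasFDerivWithinAt f D S z) : act S X f z = extC D (X z) := by
  have h' := h.differentiableWithinAt.hasFDerivWithinAt
  rw [act_eq_extC, extC, extC, hS.hasFDerivWithinAt_unique hz hX.1 h' h,
    hS.hasFDerivWithinAt_unique hz hX.2 h' h]

theorem act_congr {X : C2 → CVec} {f g : C2 → ℂ} (h : Set.EqOn f g S) {z : C2} (hz : z ∈ S) :
    act S X f z = act S X g z := by
  rw [act_eq_extC, act_eq_extC, fderivWithin_congr h (h hz)]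

theorem act_smul_field {X : C2 → CVec} {z : C2} {Y : C2 → CVec} {c : ℂ} (h : X z = c • Y z)
    (f : C2 → ℂ) : act S X f z = c * act S Y f z := by
  rw [act_eq_extC, act_eq_extC, h, extC_smul]

theorem IsHypersurface.act_mul (hS : IsHypersurface S U ρ) {z : C2} (hz : z ∈ S) {X : C2 → CVec}
    (hX : IsTangentAt ρ z (X z)) {f g : C2 → ℂ} (hf : SmoothOn S f) (hg : SmoothOn S g) :
    act S X (fun x => f x * g x) z = f z * act S X g z + g z * act S X f z := by
  have hf' := (hf.differentiableWithinAt hz).hasFDerivWithinAt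
  have hg' := (hg.differentiableWithinAt hz).hasFDerivWithinAt
  refine (hS.act_eq hz hX (hf'.mul hg')).trans ?_
  rw [hS.act_eq hz hX hf', hS.act_eq hz hX hg']
  simp [extC]
  ring

theorem IsHypersurface.act_sub (hS : IsHypersurface S U ρ) {z : C2} (hz : z ∈ S) {X : C2 → CVec}
    (hX : IsTangentAt ρ z (X z)) {f g : C2 → ℂ} (hf : SmoothOn S f) (hg : SmoothOn S g) :
    act S X (fun x => f x - g x) z = act S X f z - act S X g z := by
  have hf' := (hf.differentiableWithinAt hz).hasFDerivWithinAt
  have hg' := (hg.differentiableWithinAt hz).hasFDerivWithinAt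
  refine (hS.act_eq hz hX (hf'.sub hg')).trans ?_
  rw [hS.act_eq hz hX hf', hS.act_eq hz hX hg']
  simp [extC]
  ring

theorem IsHypersurface.act_neg (hS : IsHypersurface S U ρ) {z : C2} (hz : z ∈ S) {X : C2 → CVec}
    (hX : IsTangentAt ρ z (X z)) {f : C2 → ℂ} (hf : SmoothOn S f) :
    act S X (fun x => -f x) z = -act S X f z := by
  have hf' := (hf.differentiableWithinAt hz).hasFDerivWithinAt
  refine (hS.act_eq hz hX hf'.neg).trans ?_
  rw [hS.act_eq hz hX hf']
  simp [extC]
  ring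

theorem IsHypersurface.smoothOn_act (hS : IsHypersurface S U ρ) {X : C2 → CVec}
    (hX : IsTangentialField S ρ X) {f : C2 → ℂ} (hf : SmoothOn S f) :
    SmoothOn S (act S X f) := by
  intro z hz
  obtain ⟨O, k, hO, hzO, hk, he⟩ := hf z hz
  obtain ⟨O', A, hO', hzO', hA, heA⟩ := hX.1 z hz
  have hk' : ContDiffOn ℝ ∞ (fderiv ℝ k) (O ∩ O') :=
    (hk.fderiv_of_isOpen hO (by simp)).mono Set.inter_subset_left
  have hA' := hA.mono (Set.inter_subset_right (s := O))
  refine ⟨O ∩ O', fun x => extC (fderiv ℝ k x) (A x), hO.inter hO', ⟨hzO, hzO'⟩,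
    (hk'.clm_apply (contDiff_re.comp_contDiffOn hA')).add
      (contDiffOn_const.mul (hk'.clm_apply (contDiff_im.comp_contDiffOn hA'))), ?_⟩
  rintro x ⟨hxS, hxO, hxO'⟩
  change _ = extC _ _
  rw [← heA ⟨hxS, hxO'⟩]
  apply hS.act_eq hxS (hX.2 x hxS)
  have hd : HasFDerivAt k (fderiv ℝ k x) x :=
    ((hk.contDiffAt (hO.mem_nhds hxO)).differentiableAt (by simp)).hasFDerivAt
  refine hd.hasFDerivWithinAt.congr_of_eventuallyEq ?_ (he ⟨hxS, hxO⟩)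
  filter_upwards [inter_mem_nhdsWithin S (hO.mem_nhds hxO)] with y hy using he hy

theorem isRelOpen_self (S : Set C2) : IsRelOpen S S := ⟨Set.univ, isOpen_univ, by simp⟩

end Hypersurface

/-! ### The complex tangent line misses the origin -/

section DualMap

variable {S U : Set C2} {ρ : C2 → ℝ}

/-- The complex radial derivative `z₁ ρ_{z₁} + z₂ ρ_{z₂}`, the denominator of the dual map. -/
def radialDz (ρ : C2 → ℝ) (z : C2) : ℂ := z.1 * dz1 ρ z + z.2 * dz2 ρ z

theorem fderiv_eq_re_dz (ρ : C2 → ℝ) (z v : C2) :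
    fderiv ℝ ρ z v = 2 * (dz1 ρ z * v.1 + dz2 ρ z * v.2).re := by
  have h := congrArg Complex.re (fderiv_eq_dz ρ z v)
  simp at h
  rw [h]
  simp
  ring

theorem IsHypersurface.hasFDerivAt_fderiv (hS : IsHypersurface S U ρ) {z : C2} (hz : z ∈ S) :
    HasFDerivAt (fderiv ℝ ρ) (fderiv ℝ (fderiv ℝ ρ) z) z :=
  (((hS.smooth.fderiv_of_isOpen (m := ∞) hS.isOpen (by simp)).contDiffAt
    (hS.isOpen.mem_nhds (hS.subset hz))).differentiableAt (by simp)).hasFDerivAt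

theorem IsHypersurface.hasFDerivAt (hS : IsHypersurface S U ρ) {z : C2} (hz : z ∈ S) :
    HasFDerivAt ρ (fderiv ℝ ρ z) z :=
  ((hS.smooth.contDiffAt
    (hS.isOpen.mem_nhds (hS.subset hz))).differentiableAt (by simp)).hasFDerivAt

theorem IsHypersurface.eq_zero (hS : IsHypersurface S U ρ) {z : C2} (hz : z ∈ S) : ρ z = 0 := by
  rw [hS.eq_zeroSet] at hz
  exact hz.2

/-- A real hyperplane of `ℂ²` is not a complex subspace. Hence a circular hypersurface does not
pass through the origin, where its tangent hyperplane would be invariant under multiplication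
by `i`. -/
theorem IsHypersurface.zero_notMem (hS : IsHypersurface S U ρ) (hcirc : IsCircular S) :
    (0 : C2) ∉ S := by
  intro h0
  have hinv : ∀ v, fderiv ℝ ρ 0 v = 0 → fderiv ℝ ρ 0 (Complex.I • v) = 0 := by
    intro v hv
    obtain ⟨c, hc0, hc, hcS⟩ := hS.exists_curve h0 hv
    have hI : HasDerivAt (fun t => Complex.I • c t) (Complex.I • v) 0 :=
      hc.fun_const_smul Complex.I
    have hρ : HasFDerivAt ρ (fderiv ℝ ρ 0) (Complex.I • c 0) := by
      rw [hc0, smul_zero]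
      exact hS.hasFDerivAt h0
    have hd : HasDerivAt (fun t => ρ (Complex.I • c t)) (fderiv ℝ ρ 0 (Complex.I • v)) 0 :=
      hρ.comp_hasDerivAt (0 : ℝ) hI
    refine hd.unique ((hasDerivAt_const (0 : ℝ) (0 : ℝ)).congr_of_eventuallyEq ?_)
    filter_upwards [hcS] with t ht
    have h := hcirc (Real.pi / 2) _ ht
    push_cast at h
    rw [Complex.exp_pi_div_two_mul_I] at h
    exact hS.eq_zero h
  apply hS.fderiv_ne_zero 0 h0
  refine ContinuousLinearMap.ext fun v => ?_
  have hII : Complex.I • Complex.I • v = -v := by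
    rw [smul_smul, Complex.I_mul_I, neg_smul, one_smul]
  -- With `ℓ = dρ₀`, the vector `ℓ(iv) v - ℓ(v) iv` is tangent, and `ℓ` takes the value
  -- `ℓ(iv)² + ℓ(v)²` on its multiple by `i`.
  have h := hinv (fderiv ℝ ρ 0 (Complex.I • v) • v - fderiv ℝ ρ 0 v • Complex.I • v)
    (by simp [mul_comm])
  rw [smul_sub, smul_comm Complex.I, smul_comm Complex.I (fderiv ℝ ρ 0 v), hII] at h
  simp only [map_sub, map_smul, map_neg, smul_eq_mul] at h
  change fderiv ℝ ρ 0 v = 0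
  nlinarith [sq_nonneg (fderiv ℝ ρ 0 (Complex.I • v)), sq_nonneg (fderiv ℝ ρ 0 v)]

/-- The complex tangent lines of a circular strongly `ℂ`-convex hypersurface miss the origin:
otherwise the velocity `iz` of the rotation orbit of `z` would be a complex tangent vector, on
which the Hessian equals `dρ(z) = 0`. -/
theorem IsHypersurface.radialDz_ne_zero (hS : IsHypersurface S U ρ)
    (hconv : IsStronglyCConvex S ρ) (hcirc : IsCircular S) {z : C2} (hz : z ∈ S) :
    radialDz ρ z ≠ 0 := by
  intro h0
  let c : ℝ → C2 := fun θ => Complex.exp (θ * Complex.I) • z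
  have hcS : ∀ θ, c θ ∈ S := fun θ => hcirc θ z hz
  have hc0 : c 0 = z := by simp [c]
  have hc : ∀ θ, HasDerivAt c (Complex.I • c θ) θ := by
    intro θ
    have h1 : HasDerivAt (fun t : ℝ => Complex.exp (t * Complex.I))
        (Complex.exp (θ * Complex.I) * (1 * Complex.I)) θ :=
      ((Complex.ofRealCLM.hasDerivAt (x := θ)).mul_const Complex.I).cexp
    have h2 := h1.smul_const z
    rwa [one_mul, mul_comm, mul_smul] at h2
  have hd : ∀ θ, fderiv ℝ ρ (c θ) (Complex.I • c θ) = 0 := by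
    intro θ
    have h1 : HasDerivAt (fun t => ρ (c t)) (fderiv ℝ ρ (c θ) (Complex.I • c θ)) θ :=
      (hS.hasFDerivAt (hcS θ)).comp_hasDerivAt θ (hc θ)
    have h2 : (fun t => ρ (c t)) = fun _ => 0 := funext fun t => hS.eq_zero (hcS t)
    rw [h2] at h1
    exact h1.unique (hasDerivAt_const θ 0)
  have hdd : HasDerivAt (fun θ => fderiv ℝ ρ (c θ) (Complex.I • c θ))
      (fderiv ℝ (fderiv ℝ ρ) (c 0) (Complex.I • c 0) (Complex.I • c 0) +
        fderiv ℝ ρ (c 0) (Complex.I • Complex.I • c 0)) 0 :=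
    ((hS.hasFDerivAt_fderiv (hcS 0)).comp_hasDerivAt (0 : ℝ) (hc 0)).clm_apply
      ((hc 0).const_smul Complex.I)
  have h2 : (fun θ => fderiv ℝ ρ (c θ) (Complex.I • c θ)) = fun _ => 0 := funext hd
  rw [h2] at hdd
  have h3 := hdd.unique (hasDerivAt_const (0 : ℝ) (0 : ℝ))
  have hII : Complex.I • Complex.I • z = -z := by
    rw [smul_smul, Complex.I_mul_I, neg_smul, one_smul]
  have hρz : fderiv ℝ ρ z z = 0 := by
    rw [fderiv_eq_re_dz]
    simp only [radialDz] at h0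
    rw [show dz1 ρ z * z.1 + dz2 ρ z * z.2 = 0 by linear_combination h0]
    simp
  have hIz : fderiv ℝ ρ z (Complex.I • z) = 0 := by simpa [hc0] using hd 0
  rw [hc0, hII, map_neg, hρz, neg_zero, add_zero] at h3
  have hz0 : z ≠ 0 := by
    rintro rfl
    exact hS.zero_notMem hcirc hz
  have hpos := hconv z hz (Complex.I • z) ⟨hIz, by rw [hII, map_neg, hρz, neg_zero]⟩
    (smul_ne_zero Complex.I_ne_zero hz0)
  exact hpos.ne' h3

/-! ### The differential of the dual map -/

theorem contDiffOn_dz1 (hU : IsOpen U) (hρ : ContDiffOn ℝ ∞ ρ U) :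
    ContDiffOn ℝ ∞ (dz1 ρ) U := by
  have h := hρ.fderiv_of_isOpen (m := ∞) hU (by simp)
  have hc : ∀ v : C2, ContDiffOn ℝ ∞ (fun z => ((fderiv ℝ ρ z v : ℝ) : ℂ)) U := fun v =>
    Complex.ofRealCLM.contDiff.comp_contDiffOn (h.clm_apply contDiffOn_const)
  exact contDiffOn_const.mul ((hc _).sub (contDiffOn_const.mul (hc _)))

theorem contDiffOn_dz2 (hU : IsOpen U) (hρ : ContDiffOn ℝ ∞ ρ U) :
    ContDiffOn ℝ ∞ (dz2 ρ) U := by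
  have h := hρ.fderiv_of_isOpen (m := ∞) hU (by simp)
  have hc : ∀ v : C2, ContDiffOn ℝ ∞ (fun z => ((fderiv ℝ ρ z v : ℝ) : ℂ)) U := fun v =>
    Complex.ofRealCLM.contDiff.comp_contDiffOn (h.clm_apply contDiffOn_const)
  exact contDiffOn_const.mul ((hc _).sub (contDiffOn_const.mul (hc _)))

theorem contDiffOn_radialDz (hU : IsOpen U) (hρ : ContDiffOn ℝ ∞ ρ U) :
    ContDiffOn ℝ ∞ (radialDz ρ) U :=
  (contDiff_fst.contDiffOn.mul (contDiffOn_dz1 hU hρ)).add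
    (contDiff_snd.contDiffOn.mul (contDiffOn_dz2 hU hρ))

/-- The open set on which the formula for the dual map is meaningful. -/
def dualDomain (U : Set C2) (ρ : C2 → ℝ) : Set C2 := U ∩ radialDz ρ ⁻¹' {0}ᶜ

theorem isOpen_dualDomain (hU : IsOpen U) (hρ : ContDiffOn ℝ ∞ ρ U) : IsOpen (dualDomain U ρ) :=
  (contDiffOn_radialDz hU hρ).continuousOn.isOpen_inter_preimage hU isOpen_compl_singleton

theorem contDiffOn_dualMap (hU : IsOpen U) (hρ : ContDiffOn ℝ ∞ ρ U) :
    ContDiffOn ℝ ∞ (dualMap ρ) (dualDomain U ρ) := by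
  have h := ((contDiffOn_radialDz hU hρ).mono Set.inter_subset_left).inv
    fun z (hz : z ∈ dualDomain U ρ) => hz.2
  have h1 := ((contDiffOn_dz1 hU hρ).mono (Set.inter_subset_left (t := radialDz ρ ⁻¹' {0}ᶜ))).mul h
  have h2 := ((contDiffOn_dz2 hU hρ).mono (Set.inter_subset_left (t := radialDz ρ ⁻¹' {0}ᶜ))).mul h
  exact (h1.prodMk h2).congr fun z _ => rfl

theorem dualMap_pairing {z : C2} (hz : radialDz ρ z ≠ 0) :
    z.1 * (dualMap ρ z).1 + z.2 * (dualMap ρ z).2 = 1 := by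
  simp only [dualMap]
  rw [radialDz] at hz
  field_simp

theorem dz1_eq {z : C2} (hz : radialDz ρ z ≠ 0) :
    dz1 ρ z = radialDz ρ z * (dualMap ρ z).1 := by
  change dz1 ρ z = radialDz ρ z * (dz1 ρ z / radialDz ρ z)
  field_simp

theorem dz2_eq {z : C2} (hz : radialDz ρ z ≠ 0) :
    dz2 ρ z = radialDz ρ z * (dualMap ρ z).2 := by
  change dz2 ρ z = radialDz ρ z * (dz2 ρ z / radialDz ρ z)
  field_simp

theorem hasFDerivAt_dualMap (hU : IsOpen U) (hρ : ContDiffOn ℝ ∞ ρ U) {z : C2}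
    (hz : z ∈ dualDomain U ρ) :
    HasFDerivAt (dualMap ρ) (fderiv ℝ (dualMap ρ) z) z :=
  (((contDiffOn_dualMap hU hρ).contDiffAt
    ((isOpen_dualDomain hU hρ).mem_nhds hz)).differentiableAt (by simp)).hasFDerivAt

/-- The differentiated relation `z · w = 1`. -/
theorem pairing_fderiv_dualMap (hU : IsOpen U) (hρ : ContDiffOn ℝ ∞ ρ U) {z : C2}
    (hz : z ∈ dualDomain U ρ) (v : C2) :
    z.1 * (fderiv ℝ (dualMap ρ) z v).1 + z.2 * (fderiv ℝ (dualMap ρ) z v).2 +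
      (v.1 * (dualMap ρ z).1 + v.2 * (dualMap ρ z).2) = 0 := by
  have hw := hasFDerivAt_dualMap hU hρ hz
  have h := ((hasFDerivAt_fst (𝕜 := ℝ) (p := z)).mul hw.fst).add
    ((hasFDerivAt_snd (𝕜 := ℝ) (p := z)).mul hw.snd)
  have h1 : HasFDerivAt (fun _ : C2 => (1 : ℂ)) (0 : C2 →L[ℝ] ℂ) z := hasFDerivAt_const _ _
  have h2 := (h1.congr_of_eventuallyEq (f₁ := fun x : C2 =>
      x.1 * (dualMap ρ x).1 + x.2 * (dualMap ρ x).2) (by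
    filter_upwards [(isOpen_dualDomain hU hρ).mem_nhds hz] with x hx
    exact dualMap_pairing hx.2)).unique h
  have h3 := congrArg (fun L : C2 →L[ℝ] ℂ => L v) h2
  simp at h3
  linear_combination -h3

theorem pairing_mapC_dualMap (hU : IsOpen U) (hρ : ContDiffOn ℝ ∞ ρ U) {z : C2}
    (hz : z ∈ dualDomain U ρ) (A : CVec) :
    z.1 * (mapC (fderiv ℝ (dualMap ρ) z) A).1.1 + z.2 * (mapC (fderiv ℝ (dualMap ρ) z) A).1.2 +
      (A.1.1 * (dualMap ρ z).1 + A.1.2 * (dualMap ρ z).2) = 0 := by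
  have h1 := pairing_fderiv_dualMap hU hρ hz A.re
  have h2 := pairing_fderiv_dualMap hU hρ hz A.im
  rw [CVec.fst_eq A]
  simp only [mapC, CVec.ofReIm, Prod.fst_add, Prod.snd_add, Prod.smul_fst, Prod.smul_snd,
    smul_eq_mul]
  linear_combination h1 + Complex.I * h2

/-- On complex tangent vectors the Hessian is the differential of the dual map, paired with the
vector: in `dρ(v) = 2 Re (λ (w · v))`, where `λ` is the radial derivative, only the factor `w` needs
to be differentiated, as `w · v = 0`. -/
theorem IsHypersurface.hessian_eq (hS : IsHypersurface S U ρ) {z v : C2} (hzS : z ∈ S)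
    (hz : z ∈ dualDomain U ρ) (hv : v.1 * (dualMap ρ z).1 + v.2 * (dualMap ρ z).2 = 0) :
    fderiv ℝ (fderiv ℝ ρ) z v v = 2 * (radialDz ρ z *
      (v.1 * (fderiv ℝ (dualMap ρ) z v).1 + v.2 * (fderiv ℝ (dualMap ρ) z v).2)).re := by
  have hw := hasFDerivAt_dualMap hS.isOpen hS.smooth hz
  have hl : HasFDerivAt (radialDz ρ) (fderiv ℝ (radialDz ρ) z) z :=
    (((contDiffOn_radialDz hS.isOpen hS.smooth).contDiffAt
      (hS.isOpen.mem_nhds hz.1)).differentiableAt (by simp)).hasFDerivAt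
  have hp := hl.mul ((hw.fst.const_mul v.1).add (hw.snd.const_mul v.2))
  have hre : HasFDerivAt (fun x => 2 * (radialDz ρ x *
      (v.1 * (dualMap ρ x).1 + v.2 * (dualMap ρ x).2)).re) _ z :=
    (Complex.reCLM.hasFDerivAt.comp z hp).const_mul 2
  have hf : HasFDerivAt (fun x => fderiv ℝ ρ x v) _ z :=
    (hS.hasFDerivAt_fderiv hzS).clm_apply (hasFDerivAt_const v z)
  have he : (fun x => fderiv ℝ ρ x v) =ᶠ[𝓝 z] fun x => 2 * (radialDz ρ x *
      (v.1 * (dualMap ρ x).1 + v.2 * (dualMap ρ x).2)).re := by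
    filter_upwards [(isOpen_dualDomain hS.isOpen hS.smooth).mem_nhds hz] with x hx
    rw [fderiv_eq_re_dz]
    congr 2
    linear_combination v.1 * dz1_eq hx.2 + v.2 * dz2_eq hx.2
  have h := congrArg (fun L : C2 →L[ℝ] ℝ => L v) (hf.unique (hre.congr_of_eventuallyEq he))
  simp [hv] at h
  rw [h]
  simp
  ring

theorem IsHypersurface.mem_dualDomain (hS : IsHypersurface S U ρ)
    (hconv : IsStronglyCConvex S ρ) (hcirc : IsCircular S) {z : C2} (hz : z ∈ S) :
    z ∈ dualDomain U ρ :=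
  ⟨hS.subset hz, hS.radialDz_ne_zero hconv hcirc hz⟩

theorem IsHypersurface.pairing_pos (hS : IsHypersurface S U ρ) (hconv : IsStronglyCConvex S ρ)
    {z v : C2} (hzS : z ∈ S) (hz : z ∈ dualDomain U ρ) (hv0 : v ≠ 0)
    (hv : v.1 * (dualMap ρ z).1 + v.2 * (dualMap ρ z).2 = 0) :
    0 < (radialDz ρ z *
      (v.1 * (fderiv ℝ (dualMap ρ) z v).1 + v.2 * (fderiv ℝ (dualMap ρ) z v).2)).re := by
  have h0 : dz1 ρ z * v.1 + dz2 ρ z * v.2 = 0 := by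
    rw [dz1_eq hz.2, dz2_eq hz.2]
    linear_combination radialDz ρ z * hv
  have h1 : dz1 ρ z * (Complex.I • v).1 + dz2 ρ z * (Complex.I • v).2 = 0 := by
    simp only [Prod.smul_fst, Prod.smul_snd, smul_eq_mul]
    linear_combination Complex.I * h0
  have h := hconv z hzS v ⟨by rw [fderiv_eq_re_dz, h0]; simp,
    by rw [fderiv_eq_re_dz, h1]; simp⟩ hv0
  rw [hS.hessian_eq hzS hz hv] at h
  linarith

theorem IsHypersurface.injective_fderiv_dualMap (hS : IsHypersurface S U ρ)
    (hconv : IsStronglyCConvex S ρ) {z : C2} (hzS : z ∈ S) (hz : z ∈ dualDomain U ρ) :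
    Function.Injective (fderiv ℝ (dualMap ρ) z) := by
  refine (injective_iff_map_eq_zero _).2 fun v hv => ?_
  by_contra hv0
  have h := pairing_fderiv_dualMap hS.isOpen hS.smooth hz v
  rw [hv] at h
  have hpos := hS.pairing_pos hconv hzS hz hv0 (by simpa using h)
  rw [hv] at hpos
  simp at hpos

theorem IsHypersurface.isInvertible_fderiv_dualMap (hS : IsHypersurface S U ρ)
    (hconv : IsStronglyCConvex S ρ) {z : C2} (hzS : z ∈ S) (hz : z ∈ dualDomain U ρ) :
    (fderiv ℝ (dualMap ρ) z).IsInvertible := by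
  have hinj := hS.injective_fderiv_dualMap hconv hzS hz
  exact ⟨(LinearEquiv.ofInjectiveEndo (fderiv ℝ (dualMap ρ) z : C2 →ₗ[ℝ] C2)
    hinj).toContinuousLinearEquiv, ContinuousLinearMap.ext fun _ => rfl⟩

theorem IsHypersurface.mapC_fieldV (hS : IsHypersurface S U ρ) (hconv : IsStronglyCConvex S ρ)
    {z : C2} (hzS : z ∈ S) (hz : z ∈ dualDomain U ρ) :
    mapC (fderiv ℝ (dualMap ρ) z) (fieldV ρ z) = ((z.2, -z.1), 0) := by
  rw [fieldV, mapC_comp, (hS.isInvertible_fderiv_dualMap hconv hzS hz).self_comp_inverse, mapC_id]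

theorem IsHypersurface.injective_mapC (hS : IsHypersurface S U ρ) (hconv : IsStronglyCConvex S ρ)
    {z : C2} (hzS : z ∈ S) (hz : z ∈ dualDomain U ρ) :
    Function.Injective (mapC (fderiv ℝ (dualMap ρ) z)) := by
  refine Function.LeftInverse.injective (g := mapC (fderiv ℝ (dualMap ρ) z).inverse) fun A => ?_
  rw [mapC_comp, (hS.isInvertible_fderiv_dualMap hconv hzS hz).inverse_comp_self, mapC_id]

/-! ### The fields `Y`, `V` and their conjugates -/

/-- The coefficient of `V` in `Y`. -/
def coeffA (ρ : C2 → ℝ) (z : C2) : ℂ :=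
  (dualMap ρ z).2 * (mapC (fderiv ℝ (dualMap ρ) z) (fieldY ρ z)).1.1 -
    (dualMap ρ z).1 * (mapC (fderiv ℝ (dualMap ρ) z) (fieldY ρ z)).1.2

/-- The coefficient of `V` in `Ȳ`. -/
def coeffB (ρ : C2 → ℝ) (z : C2) : ℂ :=
  (dualMap ρ z).2 * (mapC (fderiv ℝ (dualMap ρ) z) (fieldY ρ z).conj).1.1 -
    (dualMap ρ z).1 * (mapC (fderiv ℝ (dualMap ρ) z) (fieldY ρ z).conj).1.2

/-- If `z · w = 1`, then the vectors `u` with `z · u = 0` are the multiples of `(z₂, -z₁)`. -/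
theorem eq_smul_of_pairing_eq_zero {z w u : C2} (hzw : z.1 * w.1 + z.2 * w.2 = 1)
    (hu : z.1 * u.1 + z.2 * u.2 = 0) : u = (w.2 * u.1 - w.1 * u.2) • ((z.2, -z.1) : C2) := by
  ext
  · simp only [Prod.smul_fst, smul_eq_mul]
    linear_combination -u.1 * hzw + w.1 * hu
  · simp only [Prod.smul_snd, smul_eq_mul]
    linear_combination -u.2 * hzw + w.2 * hu

theorem mapC_fieldY_fst (hU : IsOpen U) (hρ : ContDiffOn ℝ ∞ ρ U) {z : C2}
    (hz : z ∈ dualDomain U ρ) :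
    (mapC (fderiv ℝ (dualMap ρ) z) (fieldY ρ z)).1 = coeffA ρ z • ((z.2, -z.1) : C2) := by
  refine eq_smul_of_pairing_eq_zero (dualMap_pairing hz.2) ?_
  have h := pairing_mapC_dualMap hU hρ hz (fieldY ρ z)
  simp only [fieldY] at h ⊢
  linear_combination h

theorem mapC_conj_fieldY_fst (hU : IsOpen U) (hρ : ContDiffOn ℝ ∞ ρ U) {z : C2}
    (hz : z ∈ dualDomain U ρ) :
    (mapC (fderiv ℝ (dualMap ρ) z) (fieldY ρ z).conj).1 = coeffB ρ z • ((z.2, -z.1) : C2) := by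
  refine eq_smul_of_pairing_eq_zero (dualMap_pairing hz.2) ?_
  have h := pairing_mapC_dualMap hU hρ hz (fieldY ρ z).conj
  simp only [fieldY, CVec.conj] at h ⊢
  simpa using h

/-- `Ȳ = b V + ā V̄`. -/
theorem IsHypersurface.conj_fieldY_eq (hS : IsHypersurface S U ρ) (hconv : IsStronglyCConvex S ρ)
    {z : C2} (hzS : z ∈ S) (hz : z ∈ dualDomain U ρ) :
    (fieldY ρ z).conj = coeffB ρ z • fieldV ρ z + star (coeffA ρ z) • (fieldV ρ z).conj := by
  apply hS.injective_mapC hconv hzS hz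
  have ha := mapC_fieldY_fst hS.isOpen hS.smooth hz
  have hb := mapC_conj_fieldY_fst hS.isOpen hS.smooth hz
  rw [mapC_add, mapC_smul, mapC_smul, mapC_conj _ (fieldV ρ z),
    hS.mapC_fieldV hconv hzS hz]
  refine Prod.ext ?_ ?_
  · rw [hb]
    simp [CVec.conj]
  · rw [mapC_conj]
    ext <;> simp [CVec.conj, ha]

/-- Averaging the Hessian over the complex tangent vectors `E` and `iE`, where `Y = E · ∂_z`, leaves
a multiple of the real part of `λ b`: strong `ℂ`-convexity implies `b ≠ 0`. -/
theorem IsHypersurface.coeffB_ne_zero (hS : IsHypersurface S U ρ) (hconv : IsStronglyCConvex S ρ)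
    {z : C2} (hzS : z ∈ S) (hz : z ∈ dualDomain U ρ) : coeffB ρ z ≠ 0 := by
  intro hb
  set w := dualMap ρ z with hw
  have hzw : z.1 * w.1 + z.2 * w.2 = 1 := dualMap_pairing hz.2
  let E : C2 := (w.2, -w.1)
  have hE0 : E ≠ 0 := by
    intro h
    simp only [E, Prod.mk_eq_zero, neg_eq_zero] at h
    rw [h.1, h.2] at hzw
    simp at hzw
  have h1 := hS.pairing_pos hconv hzS hz hE0 (by simp only [E, ← hw]; ring)
  have h2 := hS.pairing_pos hconv hzS hz (smul_ne_zero Complex.I_ne_zero hE0)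
    (by simp [E, ← hw]; ring)
  have hre : CVec.re (fieldY ρ z).conj = (1 / 2 : ℝ) • E := by
    rw [CVec.re_conj]
    ext <;> simp [CVec.re, fieldY, E, ← hw]
  have him : CVec.im (fieldY ρ z).conj = (1 / 2 : ℝ) • (Complex.I • E) := by
    rw [CVec.im_conj]
    ext <;> simp [CVec.im, fieldY, E, ← hw] <;> ring
  have hM := mapC_conj_fieldY_fst hS.isOpen hS.smooth hz
  rw [hb, zero_smul, mapC, hre, him, map_smul, map_smul, CVec.ofReIm] at hM
  have hM1 := congrArg Prod.fst hM
  have hM2 := congrArg Prod.snd hM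
  simp at hM1 hM2
  have hsum : radialDz ρ z * (E.1 * (fderiv ℝ (dualMap ρ) z E).1 +
      E.2 * (fderiv ℝ (dualMap ρ) z E).2) + radialDz ρ z *
      ((Complex.I • E).1 * (fderiv ℝ (dualMap ρ) z (Complex.I • E)).1 +
      (Complex.I • E).2 * (fderiv ℝ (dualMap ρ) z (Complex.I • E)).2) = 0 := by
    simp only [Prod.smul_fst, Prod.smul_snd, smul_eq_mul]
    linear_combination 2 * radialDz ρ z * E.1 * hM1 + 2 * radialDz ρ z * E.2 * hM2
  have h3 := congrArg Complex.re hsum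
  rw [Complex.add_re, Complex.zero_re] at h3
  linarith

/-- A complex vector is tangent as soon as its two components are annihilated by `w` and `w̄`. -/
theorem isTangentAt_of_pairing {z : C2} (hz : radialDz ρ z ≠ 0) {A : CVec}
    (h1 : A.1.1 * (dualMap ρ z).1 + A.1.2 * (dualMap ρ z).2 = 0)
    (h2 : A.2.1 * star (dualMap ρ z).1 + A.2.2 * star (dualMap ρ z).2 = 0) :
    IsTangentAt ρ z A := by
  rw [isTangentAt_iff, dz1_eq hz, dz2_eq hz, star_mul, star_mul]
  linear_combination radialDz ρ z * h1 + star (radialDz ρ z) * h2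

theorem pairing_of_isTangentAt {z : C2} (hz : radialDz ρ z ≠ 0) {A : CVec}
    (h1 : A.1.1 * (dualMap ρ z).1 + A.1.2 * (dualMap ρ z).2 = 0) (h : IsTangentAt ρ z A) :
    A.2.1 * star (dualMap ρ z).1 + A.2.2 * star (dualMap ρ z).2 = 0 := by
  rw [isTangentAt_iff, dz1_eq hz, dz2_eq hz, star_mul, star_mul] at h
  apply mul_left_cancel₀ (star_ne_zero.2 hz)
  linear_combination h - radialDz ρ z * h1

/-- The dual-CR structure: the tangential vectors annihilating `w₁` and `w₂` are the multiples of
`Y - (a/b) Ȳ`. -/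
theorem IsHypersurface.eq_smul_of_mapC_fst_eq_zero (hS : IsHypersurface S U ρ)
    (hconv : IsStronglyCConvex S ρ) {z : C2} (hzS : z ∈ S) (hz : z ∈ dualDomain U ρ) {A : CVec}
    (hA : IsTangentAt ρ z A) (hM : (mapC (fderiv ℝ (dualMap ρ) z) A).1 = 0) :
    A = (z.2 * A.1.1 - z.1 * A.1.2) •
      (fieldY ρ z + (-(coeffA ρ z / coeffB ρ z)) • (fieldY ρ z).conj) := by
  have hzw := dualMap_pairing hz.2
  have h1 := pairing_mapC_dualMap hS.isOpen hS.smooth hz A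
  rw [hM] at h1
  have hw1 : A.1.1 * (dualMap ρ z).1 + A.1.2 * (dualMap ρ z).2 = 0 := by simpa using h1
  have hw2 := pairing_of_isTangentAt hz.2 hw1 hA
  have e1 := eq_smul_of_pairing_eq_zero (z := dualMap ρ z) (w := z) (u := A.1)
    (by linear_combination hzw) (by linear_combination hw1)
  have hzw' := congrArg star hzw
  simp only [star_add, star_mul, star_one] at hzw'
  have e2 := eq_smul_of_pairing_eq_zero (z := star (dualMap ρ z)) (w := star z) (u := A.2)
    (by simp only [Prod.fst_star, Prod.snd_star]; linear_combination hzw')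
    (by simp only [Prod.fst_star, Prod.snd_star]; linear_combination hw2)
  set h := z.2 * A.1.1 - z.1 * A.1.2
  set k := (star z).2 * A.2.1 - (star z).1 * A.2.2
  have hb := hS.coeffB_ne_zero hconv hzS hz
  have hAe : A = h • fieldY ρ z + k • (fieldY ρ z).conj := by
    refine Prod.ext ?_ ?_
    · rw [e1]
      simp [fieldY, CVec.conj]
    · rw [e2]
      ext <;> simp [fieldY, CVec.conj]
  have hM' := hM
  rw [hAe, mapC_add, mapC_smul, mapC_smul, Prod.fst_add, Prod.smul_fst, Prod.smul_fst,
    mapC_fieldY_fst hS.isOpen hS.smooth hz, mapC_conj_fieldY_fst hS.isOpen hS.smooth hz,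
    smul_smul, smul_smul, ← add_smul] at hM'
  have hz0 : ((z.2, -z.1) : C2) ≠ 0 := by
    intro h0
    simp only [Prod.mk_eq_zero, neg_eq_zero] at h0
    rw [h0.1, h0.2] at hzw
    simp at hzw
  have hk : h * coeffA ρ z + k * coeffB ρ z = 0 := (smul_eq_zero.1 hM').resolve_right hz0
  have hk' : k = h * (-(coeffA ρ z / coeffB ρ z)) := by
    field_simp
    linear_combination hk
  rw [smul_add, smul_smul, ← hk']
  exact hAe

/-- The CR structure: the tangential vectors of type `(0,1)` are the multiples of `Ȳ`. -/
theorem eq_smul_conj_fieldY {z : C2} (hz : radialDz ρ z ≠ 0) {A : CVec}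
    (hA : IsTangentAt ρ z A) (h0 : A.1 = 0) :
    A = (star z.2 * A.2.1 - star z.1 * A.2.2) • (fieldY ρ z).conj := by
  have hzw := congrArg star (dualMap_pairing hz)
  simp only [star_add, star_mul, star_one] at hzw
  have hw2 := pairing_of_isTangentAt hz (by simp [h0]) hA
  have e2 := eq_smul_of_pairing_eq_zero (z := star (dualMap ρ z)) (w := star z) (u := A.2)
    (by simp only [Prod.fst_star, Prod.snd_star]; linear_combination hzw)
    (by simp only [Prod.fst_star, Prod.snd_star]; linear_combination hw2)
  refine Prod.ext ?_ ?_
  · rw [h0]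
    simp [fieldY, CVec.conj]
  · conv_lhs => rw [e2]
    ext <;> simp [fieldY, CVec.conj]

theorem isTangentAt_fieldY {z : C2} (hz : radialDz ρ z ≠ 0) : IsTangentAt ρ z (fieldY ρ z) :=
  isTangentAt_of_pairing hz (by simp only [fieldY]; ring) (by simp [fieldY])

theorem isTangentAt_conj_fieldY {z : C2} (hz : radialDz ρ z ≠ 0) :
    IsTangentAt ρ z (fieldY ρ z).conj :=
  isTangentAt_of_pairing hz (by simp [fieldY, CVec.conj])
    (by simp [fieldY, CVec.conj]; ring)

theorem isTangentAt_add {z : C2} {A B : CVec} (hA : IsTangentAt ρ z A) (hB : IsTangentAt ρ z B) :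
    IsTangentAt ρ z (A + B) := by
  rw [isTangentAt_iff] at *
  simp only [Prod.fst_add, Prod.snd_add]
  linear_combination hA + hB

theorem isTangentAt_smul {z : C2} {A : CVec} (c : ℂ) (hA : IsTangentAt ρ z A) :
    IsTangentAt ρ z (c • A) := by
  rw [isTangentAt_iff] at *
  simp only [Prod.smul_fst, Prod.smul_snd, smul_eq_mul]
  linear_combination c * hA

theorem IsHypersurface.isTangentAt_conj_fieldV (hS : IsHypersurface S U ρ)
    (hconv : IsStronglyCConvex S ρ) {z : C2} (hzS : z ∈ S) (hz : z ∈ dualDomain U ρ) :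
    IsTangentAt ρ z (fieldV ρ z).conj := by
  have h1 := pairing_mapC_dualMap hS.isOpen hS.smooth hz (fieldV ρ z)
  have h2 := pairing_mapC_dualMap hS.isOpen hS.smooth hz (fieldV ρ z).conj
  rw [mapC_conj] at h2
  rw [hS.mapC_fieldV hconv hzS hz] at h1 h2
  have h1' := congrArg star h1
  apply isTangentAt_of_pairing hz.2
  · simpa [CVec.conj] using h2
  · simp [CVec.conj] at h1' ⊢
    linear_combination h1'

theorem IsHypersurface.conj_fieldV_ne_zero (hS : IsHypersurface S U ρ)
    (hconv : IsStronglyCConvex S ρ) {z : C2} (hzS : z ∈ S) (hz : z ∈ dualDomain U ρ) :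
    (fieldV ρ z).conj ≠ 0 := by
  intro h
  have h2 := mapC_conj (fderiv ℝ (dualMap ρ) z) (fieldV ρ z)
  have h0 : mapC (fderiv ℝ (dualMap ρ) z) (0 : CVec) = 0 := by
    have h3 := mapC_smul (fderiv ℝ (dualMap ρ) z) 0 0
    rwa [zero_smul, zero_smul] at h3
  rw [hS.mapC_fieldV hconv hzS hz, h, h0] at h2
  have hzw := dualMap_pairing hz.2
  have e1 := congrArg (fun A : CVec => A.2.1) h2.symm
  have e2 := congrArg (fun A : CVec => A.2.2) h2.symm
  simp [CVec.conj] at e1 e2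
  simp [e1, e2] at hzw

theorem IsHypersurface.mapC_conj_fieldV_fst (hS : IsHypersurface S U ρ)
    (hconv : IsStronglyCConvex S ρ) {z : C2} (hzS : z ∈ S) (hz : z ∈ dualDomain U ρ) :
    (mapC (fderiv ℝ (dualMap ρ) z) (fieldV ρ z).conj).1 = 0 := by
  rw [mapC_conj, hS.mapC_fieldV hconv hzS hz]
  simp [CVec.conj]

end DualMap

section Fields

variable {S U : Set C2} {ρ : C2 → ℝ}

/-! ### Coordinate functions and the distinguished fields -/

theorem IsHypersurface.act_fst (hS : IsHypersurface S U ρ) {z : C2} (hz : z ∈ S) {X : C2 → CVec}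
    (hX : IsTangentAt ρ z (X z)) : act S X (fun x => x.1) z = (X z).1.1 := by
  rw [hS.act_eq hz hX hasFDerivAt_fst.hasFDerivWithinAt, CVec.fst_eq]
  simp [extC]

theorem IsHypersurface.act_snd (hS : IsHypersurface S U ρ) {z : C2} (hz : z ∈ S) {X : C2 → CVec}
    (hX : IsTangentAt ρ z (X z)) : act S X (fun x => x.2) z = (X z).1.2 := by
  rw [hS.act_eq hz hX hasFDerivAt_snd.hasFDerivWithinAt, CVec.fst_eq]
  simp [extC]

theorem IsHypersurface.isCR_fst (hS : IsHypersurface S U ρ) : IsCR S ρ S fun x => x.1 := by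
  refine ⟨.of_contDiff contDiff_fst, fun x hx b hb => ?_⟩
  rw [hS.act_fst hx hb]
  rfl

theorem IsHypersurface.isCR_snd (hS : IsHypersurface S U ρ) : IsCR S ρ S fun x => x.2 := by
  refine ⟨.of_contDiff contDiff_snd, fun x hx b hb => ?_⟩
  rw [hS.act_snd hx hb]
  rfl

theorem IsHypersurface.act_dualMap_fst (hS : IsHypersurface S U ρ) {z : C2} (hzS : z ∈ S)
    (hz : z ∈ dualDomain U ρ) {X : C2 → CVec} (hX : IsTangentAt ρ z (X z)) :
    act S X (fun x => (dualMap ρ x).1) z = (mapC (fderiv ℝ (dualMap ρ) z) (X z)).1.1 := by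
  rw [hS.act_eq hzS hX (hasFDerivAt_dualMap hS.isOpen hS.smooth hz).fst.hasFDerivWithinAt]
  simp [extC, mapC, CVec.ofReIm]

theorem IsHypersurface.act_dualMap_snd (hS : IsHypersurface S U ρ) {z : C2} (hzS : z ∈ S)
    (hz : z ∈ dualDomain U ρ) {X : C2 → CVec} (hX : IsTangentAt ρ z (X z)) :
    act S X (fun x => (dualMap ρ x).2) z = (mapC (fderiv ℝ (dualMap ρ) z) (X z)).1.2 := by
  rw [hS.act_eq hzS hX (hasFDerivAt_dualMap hS.isOpen hS.smooth hz).snd.hasFDerivWithinAt]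
  simp [extC, mapC, CVec.ofReIm]

theorem IsHypersurface.smoothOn_dualMap (hS : IsHypersurface S U ρ) (hd : S ⊆ dualDomain U ρ) :
    SmoothOn S (dualMap ρ) :=
  .of_contDiffOn (isOpen_dualDomain hS.isOpen hS.smooth) (contDiffOn_dualMap hS.isOpen hS.smooth) hd

theorem IsHypersurface.isTangentialField_fieldY (hS : IsHypersurface S U ρ)
    (hd : S ⊆ dualDomain U ρ) : IsTangentialField S ρ (fieldY ρ) := by
  have hw := hS.smoothOn_dualMap hd
  exact ⟨(hw.snd.prodMk hw.fst.neg).prodMk (.of_contDiff contDiff_const),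
    fun z hz => isTangentAt_fieldY (hd hz).2⟩

theorem IsHypersurface.isTangentialField_conj_fieldY (hS : IsHypersurface S U ρ)
    (hd : S ⊆ dualDomain U ρ) : IsTangentialField S ρ fun z => (fieldY ρ z).conj := by
  have hw := (hS.isTangentialField_fieldY hd).1
  exact ⟨hw.snd.star_vec.prodMk hw.fst.star_vec,
    fun z hz => isTangentAt_conj_fieldY (hd hz).2⟩

theorem IsHypersurface.smoothOn_mapC_dualMap (hS : IsHypersurface S U ρ)
    (hd : S ⊆ dualDomain U ρ) {X : C2 → CVec} (hX : IsTangentialField S ρ X) :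
    SmoothOn S fun z => (mapC (fderiv ℝ (dualMap ρ) z) (X z)).1 := by
  have hw := hS.smoothOn_dualMap hd
  exact ((hS.smoothOn_act hX hw.fst).prodMk (hS.smoothOn_act hX hw.snd)).congr fun z hz =>
    Prod.ext (hS.act_dualMap_fst hz (hd hz) (hX.2 z hz)).symm
      (hS.act_dualMap_snd hz (hd hz) (hX.2 z hz)).symm

theorem IsHypersurface.smoothOn_coeffA (hS : IsHypersurface S U ρ) (hd : S ⊆ dualDomain U ρ) :
    SmoothOn S (coeffA ρ) := by
  have hw := hS.smoothOn_dualMap hd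
  have h := hS.smoothOn_mapC_dualMap hd (hS.isTangentialField_fieldY hd)
  exact (hw.snd.mul h.fst).sub (hw.fst.mul h.snd)

theorem IsHypersurface.smoothOn_coeffB (hS : IsHypersurface S U ρ) (hd : S ⊆ dualDomain U ρ) :
    SmoothOn S (coeffB ρ) := by
  have hw := hS.smoothOn_dualMap hd
  have h := hS.smoothOn_mapC_dualMap hd (hS.isTangentialField_conj_fieldY hd)
  exact (hw.snd.mul h.fst).sub (hw.fst.mul h.snd)

theorem conj_fieldY_ne_zero {z : C2} (hz : radialDz ρ z ≠ 0) : (fieldY ρ z).conj ≠ 0 := by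
  intro h
  have hzw := dualMap_pairing hz
  have e1 := congrArg (fun A : CVec => A.2.1) h
  have e2 := congrArg (fun A : CVec => A.2.2) h
  simp [fieldY, CVec.conj] at e1 e2
  simp [e1, e2] at hzw

/-- The field `b⁻¹ Ȳ = V + (ā/b) V̄` annihilates exactly the CR functions. -/
theorem IsHypersurface.isCRField_conj_fieldY (hS : IsHypersurface S U ρ)
    (hconv : IsStronglyCConvex S ρ) (hd : S ⊆ dualDomain U ρ) :
    IsCRField S ρ fun z => (1 / coeffB ρ z) • (fieldY ρ z).conj := by
  have hb : ∀ z ∈ S, coeffB ρ z ≠ 0 := fun z hz => hS.coeffB_ne_zero hconv hz (hd hz)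
  have hY := hS.isTangentialField_conj_fieldY hd
  refine ⟨⟨?_, fun z hz => isTangentAt_smul _ (hY.2 z hz)⟩,
    fun z hz => smul_ne_zero (one_div_ne_zero (hb z hz)) (conj_fieldY_ne_zero (hd hz).2),
    fun W hW u hu => ?_⟩
  · exact ((SmoothOn.of_contDiff contDiff_const).div (hS.smoothOn_coeffB hd) hb).smul hY.1
  · obtain ⟨O, -, rfl⟩ := hW
    constructor
    · intro h z hz
      have h0 : (fieldY ρ z).conj = (0, (fieldY ρ z).conj.2) := by
        ext <;> simp [fieldY, CVec.conj]
      rw [act_smul_field (Y := fun _ => (0, (fieldY ρ z).conj.2)) (by rw [← h0]),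
        h.2 z hz _ (by rw [← h0]; exact hY.2 z hz.1), mul_zero]
    · refine fun h => ⟨hu, fun z hz b hA => ?_⟩
      have e := eq_smul_conj_fieldY (hd hz.1).2 hA rfl
      have h1 := h z hz
      rw [act_smul_field (Y := fun x => (fieldY ρ x).conj) rfl] at h1
      rw [act_smul_field (Y := fun x => (fieldY ρ x).conj) e,
        (mul_eq_zero.1 h1).resolve_left (one_div_ne_zero (hb z hz.1)), mul_zero]

/-- The field `Y - (a/b) Ȳ` is a multiple of `V̄`, and annihilates exactly the dual-CR
functions. -/
theorem IsHypersurface.isDualCRField_fieldY_sub (hS : IsHypersurface S U ρ)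
    (hconv : IsStronglyCConvex S ρ) (hd : S ⊆ dualDomain U ρ) :
    IsDualCRField S ρ fun z =>
      fieldY ρ z + (-(coeffA ρ z / coeffB ρ z)) • (fieldY ρ z).conj := by
  have hb : ∀ z ∈ S, coeffB ρ z ≠ 0 := fun z hz => hS.coeffB_ne_zero hconv hz (hd hz)
  have hY := hS.isTangentialField_fieldY hd
  have hY' := hS.isTangentialField_conj_fieldY hd
  refine ⟨⟨?_, fun z hz => isTangentAt_add (hY.2 z hz) (isTangentAt_smul _ (hY'.2 z hz))⟩,
    fun z hz h => ?_, fun W hW u hu => ?_⟩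
  · exact hY.1.add (((hS.smoothOn_coeffA hd).div (hS.smoothOn_coeffB hd) hb).neg.smul hY'.1)
  · have hzw := dualMap_pairing (hd hz).2
    have e1 := congrArg (fun A : CVec => A.1.1) h
    have e2 := congrArg (fun A : CVec => A.1.2) h
    simp [fieldY, CVec.conj] at e1 e2
    simp [e1, e2] at hzw
  · obtain ⟨O, -, rfl⟩ := hW
    let R : C2 → CVec := fun z =>
      fieldY ρ z + (-(coeffA ρ z / coeffB ρ z)) • (fieldY ρ z).conj
    have key : ∀ z ∈ S, ∃ c : ℂ, c ≠ 0 ∧ (fieldV ρ z).conj = c • R z := by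
      intro z hz
      have e := hS.eq_smul_of_mapC_fst_eq_zero hconv hz (hd hz)
        (hS.isTangentAt_conj_fieldV hconv hz (hd hz)) (hS.mapC_conj_fieldV_fst hconv hz (hd hz))
      refine ⟨_, fun h => hS.conj_fieldV_ne_zero hconv hz (hd hz) ?_, e⟩
      rw [e, h, zero_smul]
    constructor
    · intro h z hz
      obtain ⟨c, hc, e⟩ := key z hz.1
      have h1 := h.2 z hz
      rw [act_smul_field (X := fun x => (fieldV ρ x).conj) (Y := R) e] at h1
      exact (mul_eq_zero.1 h1).resolve_left hc
    · refine fun h => ⟨hu, fun z hz => ?_⟩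
      obtain ⟨c, -, e⟩ := key z hz.1
      rw [act_smul_field (X := fun x => (fieldV ρ x).conj) (Y := R) e, h z hz, mul_zero]

theorem IsHypersurface.exists_isDistinguishedPair (hS : IsHypersurface S U ρ)
    (hconv : IsStronglyCConvex S ρ) (hd : S ⊆ dualDomain U ρ) :
    ∃ X T : C2 → CVec, IsDistinguishedPair S ρ X T := by
  have hb : ∀ z ∈ S, coeffB ρ z ≠ 0 := fun z hz => hS.coeffB_ne_zero hconv hz (hd hz)
  refine ⟨_, _, hS.isCRField_conj_fieldY hconv hd, hS.isDualCRField_fieldY_sub hconv hd,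
    ⟨fun z => star (coeffA ρ z) / coeffB ρ z,
      (hS.smoothOn_coeffA hd).star.div (hS.smoothOn_coeffB hd) hb, fun z hz => ?_⟩,
    ⟨_, ((hS.smoothOn_coeffA hd).div (hS.smoothOn_coeffB hd) hb).neg, fun z _ => rfl⟩⟩
  rw [hS.conj_fieldY_eq hconv hz (hd hz), smul_add, smul_smul, smul_smul,
    one_div_mul_cancel (hb z hz), one_smul, one_div_mul_eq_div]

/-! ### Fields annihilating exactly the CR or the dual-CR functions -/

/-- A field annihilating the CR functions has type `(0,1)`, as it annihilates `z₁` and `z₂`. -/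
theorem IsHypersurface.fst_eq_zero_of_isCRField (hS : IsHypersurface S U ρ) {X : C2 → CVec}
    (hX : IsCRField S ρ X) {z : C2} (hz : z ∈ S) : (X z).1 = 0 := by
  have e1 := (hX.isCR_iff S (isRelOpen_self S) _ hS.isCR_fst.1).1 hS.isCR_fst z hz
  have e2 := (hX.isCR_iff S (isRelOpen_self S) _ hS.isCR_snd.1).1 hS.isCR_snd z hz
  rw [hS.act_fst hz (hX.tangential.2 z hz)] at e1
  rw [hS.act_snd hz (hX.tangential.2 z hz)] at e2
  exact Prod.ext e1 e2

/-- A field annihilating the dual-CR functions annihilates `w₁` and `w₂`. -/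
theorem IsHypersurface.mapC_fst_eq_zero_of_isDualCRField (hS : IsHypersurface S U ρ)
    (hconv : IsStronglyCConvex S ρ) (hd : S ⊆ dualDomain U ρ) {T : C2 → CVec}
    (hT : IsDualCRField S ρ T) {z : C2} (hz : z ∈ S) :
    (mapC (fderiv ℝ (dualMap ρ) z) (T z)).1 = 0 := by
  have hw := hS.smoothOn_dualMap hd
  have h1 : IsDualCR S ρ S fun x => (dualMap ρ x).1 := by
    refine ⟨hw.fst, fun x hx => ?_⟩
    rw [hS.act_dualMap_fst (X := fun x => (fieldV ρ x).conj) hx (hd hx)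
      (hS.isTangentAt_conj_fieldV hconv hx (hd hx)), hS.mapC_conj_fieldV_fst hconv hx (hd hx)]
    rfl
  have h2 : IsDualCR S ρ S fun x => (dualMap ρ x).2 := by
    refine ⟨hw.snd, fun x hx => ?_⟩
    rw [hS.act_dualMap_snd (X := fun x => (fieldV ρ x).conj) hx (hd hx)
      (hS.isTangentAt_conj_fieldV hconv hx (hd hx)), hS.mapC_conj_fieldV_fst hconv hx (hd hx)]
    rfl
  have e1 := (hT.isDualCR_iff S (isRelOpen_self S) _ h1.1).1 h1 z hz
  have e2 := (hT.isDualCR_iff S (isRelOpen_self S) _ h2.1).1 h2 z hz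
  rw [hS.act_dualMap_fst hz (hd hz) (hT.tangential.2 z hz)] at e1
  rw [hS.act_dualMap_snd hz (hd hz) (hT.tangential.2 z hz)] at e2
  exact Prod.ext e1 e2

/-- Two fields annihilating exactly the dual-CR functions are proportional; the one of the
form `Y + ψ Ȳ` normalizes the factor. -/
theorem IsHypersurface.eq_smul_of_isDualCRField (hS : IsHypersurface S U ρ)
    (hconv : IsStronglyCConvex S ρ) (hd : S ⊆ dualDomain U ρ) {T T' : C2 → CVec}
    (hT : IsDualCRField S ρ T) (hT' : IsDualCRField S ρ T') {z : C2} (hz : z ∈ S) {ψ : ℂ}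
    (hψ : T z = fieldY ρ z + ψ • (fieldY ρ z).conj) :
    T' z = (z.2 * (T' z).1.1 - z.1 * (T' z).1.2) • T z := by
  have key : ∀ {R : C2 → CVec}, IsDualCRField S ρ R → R z =
      (z.2 * (R z).1.1 - z.1 * (R z).1.2) •
        (fieldY ρ z + (-(coeffA ρ z / coeffB ρ z)) • (fieldY ρ z).conj) := fun hR =>
    hS.eq_smul_of_mapC_fst_eq_zero hconv hz (hd hz) (hR.tangential.2 z hz)
      (hS.mapC_fst_eq_zero_of_isDualCRField hconv hd hR hz)
  have h1 : z.2 * (T z).1.1 - z.1 * (T z).1.2 = 1 := by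
    have hzw := dualMap_pairing (hd hz).2
    rw [hψ]
    simp [fieldY, CVec.conj]
    linear_combination hzw
  have hTz := key hT
  rw [h1, one_smul] at hTz
  conv_lhs => rw [key hT', ← hTz]

/-- Along `X = V + φ V̄` the dual coordinates have derivatives `X w = (z₂, -z₁)`. -/
theorem IsHypersurface.mapC_fst_of_eq (hS : IsHypersurface S U ρ) (hconv : IsStronglyCConvex S ρ)
    {z : C2} (hzS : z ∈ S) (hz : z ∈ dualDomain U ρ) {A : CVec} {φ : ℂ}
    (hφ : A = fieldV ρ z + φ • (fieldV ρ z).conj) :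
    (mapC (fderiv ℝ (dualMap ρ) z) A).1 = (z.2, -z.1) := by
  rw [hφ, mapC_add, mapC_smul, Prod.fst_add, Prod.smul_fst,
    hS.mapC_conj_fieldV_fst hconv hzS hz, hS.mapC_fieldV hconv hzS hz, smul_zero, add_zero]

/-- Two fields annihilating exactly the CR functions are proportional; the one of the
form `V + φ V̄` normalizes the factor. -/
theorem IsHypersurface.eq_smul_of_isCRField (hS : IsHypersurface S U ρ)
    (hconv : IsStronglyCConvex S ρ) (hd : S ⊆ dualDomain U ρ) {X X' : C2 → CVec}
    (hX : IsCRField S ρ X) (hX' : IsCRField S ρ X') {z : C2} (hz : z ∈ S) {φ : ℂ}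
    (hφ : X z = fieldV ρ z + φ • (fieldV ρ z).conj) :
    X' z = ((dualMap ρ z).2 * act S X' (fun x => (dualMap ρ x).1) z -
      (dualMap ρ z).1 * act S X' (fun x => (dualMap ρ x).2) z) • X z := by
  have hzw := dualMap_pairing (hd hz).2
  have e := eq_smul_conj_fieldY (hd hz).2 (hX.tangential.2 z hz)
    (hS.fst_eq_zero_of_isCRField hX hz)
  have e' := eq_smul_conj_fieldY (hd hz).2 (hX'.tangential.2 z hz)
    (hS.fst_eq_zero_of_isCRField hX' hz)
  set k := star z.2 * (X z).2.1 - star z.1 * (X z).2.2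
  set k' := star z.2 * (X' z).2.1 - star z.1 * (X' z).2.2
  have hk : k ≠ 0 := by
    intro h
    apply hX.ne_zero z hz
    rw [e, h, zero_smul]
  have h1 : X' z = (k' / k) • X z := by
    rw [e, smul_smul, div_mul_cancel₀ _ hk]
    exact e'
  rw [hS.act_dualMap_fst hz (hd hz) (hX'.tangential.2 z hz),
    hS.act_dualMap_snd hz (hd hz) (hX'.tangential.2 z hz)]
  have h2 : (dualMap ρ z).2 * (mapC (fderiv ℝ (dualMap ρ) z) (X' z)).1.1 -
      (dualMap ρ z).1 * (mapC (fderiv ℝ (dualMap ρ) z) (X' z)).1.2 = k' / k := by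
    rw [h1, mapC_smul, Prod.smul_fst, hS.mapC_fst_of_eq hconv hz (hd hz) hφ]
    simp only [Prod.smul_fst, Prod.smul_snd, smul_eq_mul]
    linear_combination k' / k * hzw
  rw [h2]
  exact h1

/-- The rigidity of the fields. Write `X' = g X` and `T' = k T`. The functions `c₁ = X'T'z₁` and
`c₂ = X'T'z₂` are CR by assumption, where `T'z₁ = k w₂` and `T'z₂ = -k w₁`. As `X w = (z₂, -z₁)`,
the product rule gives `c₁ w₁ + c₂ w₂ = -g k` and `c₁ z₂ - c₂ z₁ = X'k`. Applying `X'` to the first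
identity gives `X'(g k) = -g X'k`, so that `f₃ = g k²` is CR; then `f_j = -c_j / f₃`. -/
theorem IsHypersurface.exists_factors (hS : IsHypersurface S U ρ)
    (hconv : IsStronglyCConvex S ρ) (hd : S ⊆ dualDomain U ρ) {X T X' T' : C2 → CVec}
    (hXT : IsDistinguishedPair S ρ X T) (hX' : IsCRField S ρ X') (hT' : IsDualCRField S ρ T')
    (h : ∀ u : C2 → ℂ, IsCR S ρ S u → ∀ z ∈ S, act S X' (act S X' (act S T' u)) z = 0) :
    ∃ f₁ f₂ f₃ : C2 → ℂ, IsCR S ρ S f₁ ∧ IsCR S ρ S f₂ ∧ IsCR S ρ S f₃ ∧ ∀ z ∈ S,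
      f₁ z * (dualMap ρ z).1 + f₂ z * (dualMap ρ z).2 ≠ 0 ∧ f₃ z ≠ 0 ∧
      X' z = (f₃ z * (f₁ z * (dualMap ρ z).1 + f₂ z * (dualMap ρ z).2) ^ 2) • X z ∧
      T' z = (f₁ z * (dualMap ρ z).1 + f₂ z * (dualMap ρ z).2)⁻¹ • T z := by
  obtain ⟨φ, -, hφ⟩ := hXT.X_eq
  obtain ⟨ψ, -, hψ⟩ := hXT.T_eq
  have hX := hXT.isCRField
  have htX' := hX'.tangential
  have hw := hS.smoothOn_dualMap hd
  have hcr : ∀ {u : C2 → ℂ}, SmoothOn S u → (IsCR S ρ S u ↔ ∀ z ∈ S, act S X' u z = 0) :=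
    fun hu => hX'.isCR_iff S (isRelOpen_self S) _ hu
  -- The factors `g` and `k`.
  let g : C2 → ℂ := fun z => (dualMap ρ z).2 * act S X' (fun x => (dualMap ρ x).1) z -
    (dualMap ρ z).1 * act S X' (fun x => (dualMap ρ x).2) z
  let k : C2 → ℂ := fun z => z.2 * (T' z).1.1 - z.1 * (T' z).1.2
  have hg : SmoothOn S g := (hw.snd.mul (hS.smoothOn_act htX' hw.fst)).sub
    (hw.fst.mul (hS.smoothOn_act htX' hw.snd))
  have hk : SmoothOn S k := ((SmoothOn.of_contDiff contDiff_snd).mul hT'.tangential.1.fst.fst).sub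
    ((SmoothOn.of_contDiff contDiff_fst).mul hT'.tangential.1.fst.snd)
  have hgX : ∀ z ∈ S, X' z = g z • X z := fun z hz =>
    hS.eq_smul_of_isCRField hconv hd hX hX' hz (hφ z hz)
  have hkT : ∀ z ∈ S, T' z = k z • T z := fun z hz =>
    hS.eq_smul_of_isDualCRField hconv hd hXT.isDualCRField hT' hz (hψ z hz)
  have hg0 : ∀ z ∈ S, g z ≠ 0 := fun z hz h0 => hX'.ne_zero z hz (by rw [hgX z hz, h0, zero_smul])
  have hk0 : ∀ z ∈ S, k z ≠ 0 := fun z hz h0 => hT'.ne_zero z hz (by rw [hkT z hz, h0, zero_smul])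
  -- The derivatives of the dual coordinates along `X'`, and of the coordinates along `T'`.
  have hXw₁ : ∀ z ∈ S, act S X' (fun x => (dualMap ρ x).1) z = g z * z.2 := fun z hz => by
    rw [hS.act_dualMap_fst hz (hd hz) (htX'.2 z hz), hgX z hz, mapC_smul, Prod.smul_fst,
      hS.mapC_fst_of_eq hconv hz (hd hz) (hφ z hz)]
    rfl
  have hXw₂ : ∀ z ∈ S, act S X' (fun x => (dualMap ρ x).2) z = -(g z * z.1) := fun z hz => by
    rw [hS.act_dualMap_snd hz (hd hz) (htX'.2 z hz), hgX z hz, mapC_smul, Prod.smul_fst,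
      hS.mapC_fst_of_eq hconv hz (hd hz) (hφ z hz)]
    exact mul_neg _ _
  have hTz₁ : ∀ z ∈ S, act S T' (fun x => x.1) z = k z * (dualMap ρ z).2 := fun z hz => by
    rw [hS.act_fst hz (hT'.tangential.2 z hz), hkT z hz, hψ z hz]
    simp [fieldY, CVec.conj]
  have hTz₂ : ∀ z ∈ S, act S T' (fun x => x.2) z = -(k z * (dualMap ρ z).1) := fun z hz => by
    rw [hS.act_snd hz (hT'.tangential.2 z hz), hkT z hz, hψ z hz]
    simp [fieldY, CVec.conj]
  -- The CR functions `c₁` and `c₂`.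
  let c₁ : C2 → ℂ := act S X' (act S T' fun x => x.1)
  let c₂ : C2 → ℂ := act S X' (act S T' fun x => x.2)
  have hc₁ : SmoothOn S c₁ := hS.smoothOn_act htX' (hS.smoothOn_act hT'.tangential hS.isCR_fst.1)
  have hc₂ : SmoothOn S c₂ := hS.smoothOn_act htX' (hS.smoothOn_act hT'.tangential hS.isCR_snd.1)
  have hXc₁ : ∀ z ∈ S, act S X' c₁ z = 0 := h _ hS.isCR_fst
  have hXc₂ : ∀ z ∈ S, act S X' c₂ z = 0 := h _ hS.isCR_snd
  have ec₁ : ∀ z ∈ S, c₁ z = k z * -(g z * z.1) + (dualMap ρ z).2 * act S X' k z := fun z hz => by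
    rw [← hXw₂ z hz, ← hS.act_mul hz (htX'.2 z hz) hk hw.snd]
    exact act_congr hTz₁ hz
  have ec₂ : ∀ z ∈ S, c₂ z = -(k z * (g z * z.2) + (dualMap ρ z).1 * act S X' k z) :=
    fun z hz => by
      rw [← hXw₁ z hz, ← hS.act_mul hz (htX'.2 z hz) hk hw.fst,
        ← hS.act_neg hz (htX'.2 z hz) (hk.mul hw.fst)]
      exact act_congr hTz₂ hz
  have hgk : ∀ z ∈ S, g z * k z = -((dualMap ρ z).1 * c₁ z) - (dualMap ρ z).2 * c₂ z :=
    fun z hz => by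
      rw [ec₁ z hz, ec₂ z hz]
      linear_combination -(g z * k z) * dualMap_pairing (hd hz).2
  have hXk : ∀ z ∈ S, act S X' k z = z.2 * c₁ z - z.1 * c₂ z := fun z hz => by
    rw [ec₁ z hz, ec₂ z hz]
    linear_combination -(act S X' k z) * dualMap_pairing (hd hz).2
  have hXgk : ∀ z ∈ S, act S X' (fun x => g x * k x) z = -(g z * act S X' k z) := fun z hz => by
    have ht := htX'.2 z hz
    rw [act_congr hgk hz, hS.act_sub hz ht (hw.fst.mul hc₁).neg (hw.snd.mul hc₂),
      hS.act_neg hz ht (hw.fst.mul hc₁), hS.act_mul hz ht hw.fst hc₁,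
      hS.act_mul hz ht hw.snd hc₂, hXc₁ z hz, hXc₂ z hz, hXw₁ z hz, hXw₂ z hz, hXk z hz]
    ring
  -- The CR function `f₃ = g k²`, and the quotients of CR functions by it.
  let f₃ : C2 → ℂ := fun z => g z * k z * k z
  have hf₃ : SmoothOn S f₃ := (hg.mul hk).mul hk
  have hf₃0 : ∀ z ∈ S, f₃ z ≠ 0 := fun z hz =>
    mul_ne_zero (mul_ne_zero (hg0 z hz) (hk0 z hz)) (hk0 z hz)
  have hXf₃ : ∀ z ∈ S, act S X' f₃ z = 0 := fun z hz => by
    rw [hS.act_mul hz (htX'.2 z hz) (hg.mul hk) hk, hXgk z hz]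
    ring
  have hquot : ∀ c : C2 → ℂ, SmoothOn S c → (∀ z ∈ S, act S X' c z = 0) →
      IsCR S ρ S fun z => -c z / f₃ z := by
    intro c hc hXc
    have hq := hc.neg.div hf₃ hf₃0
    refine (hcr hq).2 fun z hz => ?_
    have e : Set.EqOn (fun x => f₃ x * (-c x / f₃ x)) (fun x => -c x) S :=
      fun x hx => mul_div_cancel₀ _ (hf₃0 x hx)
    have e1 := act_congr (X := X') e hz
    rw [hS.act_mul hz (htX'.2 z hz) hf₃ hq, hS.act_neg hz (htX'.2 z hz) hc, hXc z hz,
      hXf₃ z hz, mul_zero, add_zero, neg_zero] at e1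
    exact (mul_eq_zero.1 e1).resolve_left (hf₃0 z hz)
  refine ⟨_, _, f₃, hquot c₁ hc₁ hXc₁, hquot c₂ hc₂ hXc₂, (hcr hf₃).2 hXf₃, fun z hz => ?_⟩
  have hkz := hk0 z hz
  have hgz := hg0 z hz
  have hfw : -c₁ z / f₃ z * (dualMap ρ z).1 + -c₂ z / f₃ z * (dualMap ρ z).2 = (k z)⁻¹ := by
    have e : -c₁ z / f₃ z * (dualMap ρ z).1 + -c₂ z / f₃ z * (dualMap ρ z).2 =
        g z * k z / (g z * k z * k z) := by
      simp only [f₃]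
      field_simp
      linear_combination -hgk z hz
    rw [e]
    field_simp
  refine ⟨hfw ▸ inv_ne_zero hkz, hf₃0 z hz, ?_, ?_⟩
  · rw [hfw, hgX z hz]
    congr 1
    simp only [f₃]
    field_simp
  · rw [hfw, inv_inv, hkT z hz]

end Fields

end ProjDual

end

theorem theorem5p1 (S U : Set ProjDual.C2) (ρ : ProjDual.C2 → ℝ)
    (hS : ProjDual.IsHypersurface S U ρ)
    (hconv : ProjDual.IsStronglyCConvex S ρ)
    (hcirc : ProjDual.IsCircular S) :
    (∃ X T : ProjDual.C2 → ProjDual.CVec, ProjDual.IsDistinguishedPair S ρ X T) ∧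
    ∀ X T : ProjDual.C2 → ProjDual.CVec, ProjDual.IsDistinguishedPair S ρ X T →
      ∀ X' T' : ProjDual.C2 → ProjDual.CVec,
        ProjDual.IsCRField S ρ X' → ProjDual.IsDualCRField S ρ T' →
        (∀ u : ProjDual.C2 → ℂ, ProjDual.IsCR S ρ S u → ∀ z ∈ S,
          ProjDual.act S X' (ProjDual.act S X' (ProjDual.act S T' u)) z = 0) →
        (∀ u : ProjDual.C2 → ℂ, ProjDual.IsDualCR S ρ S u → ∀ z ∈ S,
          ProjDual.act S X' (ProjDual.act S X' (ProjDual.act S T' u)) z = 0) →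
        ∃ f₁ f₂ f₃ : ProjDual.C2 → ℂ,
          ProjDual.IsCR S ρ S f₁ ∧ ProjDual.IsCR S ρ S f₂ ∧ ProjDual.IsCR S ρ S f₃ ∧
          ∀ z ∈ S,
            f₁ z * (ProjDual.dualMap ρ z).1 + f₂ z * (ProjDual.dualMap ρ z).2 ≠ 0 ∧
            f₃ z ≠ 0 ∧
            X' z = (f₃ z * (f₁ z * (ProjDual.dualMap ρ z).1
                + f₂ z * (ProjDual.dualMap ρ z).2) ^ 2) • X z ∧
            T' z = (f₁ z * (ProjDual.dualMap ρ z).1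
                + f₂ z * (ProjDual.dualMap ρ z).2)⁻¹ • T z := by
  have hd : S ⊆ ProjDual.dualDomain U ρ := fun z hz => hS.mem_dualDomain hconv hcirc hz
  refine ⟨hS.exists_isDistinguishedPair hconv hd, fun X T hXT X' T' hX' hT' h _ => ?_⟩
  exact hS.exists_factors hconv hd hXT hX' hT' h
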